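/- Let $\Gamma$ be a group (not necessarily commutative) and $R$ a $\Gamma$-graded ring (associative, with $1$). Definitions. A $\Gamma$-graded division ring is a nonzero $\Gamma$-graded ring whose nonzero homogeneous elements are invertible. A $\Gamma$-graded epic $R$-division ring is a pair $(K,\varphi)$ with $K$ a $\Gamma$-graded division ring and $\varphi\colon R\to K$ a homomorphism of graded rings such that $K$ is the least subring of $K$ that contains $\varphi(R)$ and is closed under inversion of its nonzero homogeneous elements. Let $\mathfrak M(R)$ be the set of square matrices $A$ over $R$ for which there are $\alpha,\beta\in\Gamma^n$ with $A_{ij}\in R_{\alpha_i\beta_j^{-1}}$ for all $i,j$. The singular kernel of $(K,\varphi)$ is the set of $A\in\mathfrak M(R)$ such that $A^\varphi$ is not invertible over $K$. For $\Sigma\subseteq\mathfrak M(R)$, $R_\Sigma$ is the universal localization of $R$ at $\Sigma$, with the unique $\Gamma$-grading that makes $R\to R_\Sigma$ graded. Given graded epic $R$-division rings $(K,\varphi)$, $(L,\psi)$ with $\Sigma=\{A\in\mathfrak M(R): A^\psi \text{ invertible over } L\}$, if there is a homomorphism of graded $R$-rings $R_\Sigma\to K$, its image is called the core of $L$ in $K$;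 a gr-specialization from $K$ to $L$ is a homomorphism of graded $R$-rings from this core to $L$. Let $\mathcal E_R$ be the category of $\Gamma$-graded epic $R$-division rings with gr-specializations as morphisms. A $\Gamma$-graded ring is graded local if the two-sided ideal $\mathfrak m$ generated by its noninvertible homogeneous elements is proper; its residue ring is the quotient by $\mathfrak m$. For a family $(B_i)_{i\in I}$ of $\Gamma$-graded rings and an ultrafilter $\mathfrak U$ on $I$, the graded ultraproduct is $S/Z$, where $S=\bigoplus_{\gamma}\prod_i (B_i)_\gamma\subseteq\prod_i B_i$ and $Z=\bigoplus_\gamma Z_\gamma$, with $Z_\gamma$ the set of $x\in\prod_i (B_i)_\gamma$ such that $\{i: x_i=0\}\in\mathfrak U$; graded homomorphisms $R\to B_i$ induce a graded homomorphism from $R$ to it. Theorem. Let $((K_i,\varphi_i)_{i\in I},(\psi_{i,j})_{i\ge j})$ be an inverse system in $\mathcal E_R$ indexed by a nonempty directed preordered set $I$. For $i\in I$ let $\Sigma_i=\{A\in\mathfrak M(R): A^{\varphi_i}\text{ is invertible over }K_i\}$. (1) The inverse system has an inverse limit $(K,\varphi)$ in $\mathcal E_R$. (2) The singular kernel of $(K,\varphi)$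 is the intersection of the singular kernels of the $(K_i,\varphi_i)$; equivalently, $\Sigma:=\{A\in\mathfrak M(R): A^{\varphi}\text{ is invertible over }K\}$ equals $\bigcup_{i\in I}\Sigma_i$. Let moreover $\mathfrak U$ be any ultrafilter on $I$ that contains all the sections $\{j\in I: i\le j\}$, $i\in I$, let $U$ be the graded ultraproduct of the family $(K_i)_{i\in I}$ and $V$ the graded ultraproduct of the family $(R_{\Sigma_i})_{i\in I}$, both along $\mathfrak U$. (3) $U$ is a $\Gamma$-graded division ring, and the graded division subring of $U$ generated by the image of $R$ is isomorphic to $(K,\varphi)$ as a graded $R$-ring. (4) $V$ is a graded local ring, and its residue ring is isomorphic to $U$ as a graded $R$-ring, by an isomorphism that sends the residue class of $[(x_i)_i]$, where the $x_i\in R_{\Sigma_i}$ are homogeneous of the same degree, to $[(\Phi_i(x_i))_i]$, where $\Phi_i\colon R_{\Sigma_i}\to K_i$ is the natural homomorphism. (5) There is an injective homomorphism of graded $R$-rings $R_\Sigma\to V$. -/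

import Mathlib

open CategoryTheory CategoryTheory.Limits Opposite DirectSum

universe u v w

/-!
Conventions. The grading group `Γ` is an arbitrary, not necessarily commutative, group. Mathlib
indexes gradings additively, so it is written additively: `α - β` stands for `αβ⁻¹`, and `0` for
the identity element. Rings are associative with `1`. A graded ring is a ring with a family of
additive subgroups `ℬ : Γ → AddSubgroup B` and Mathlib's `GradedRing ℬ`; a homomorphism of graded
rings is Mathlib's `𝒜 →+*ᵍ ℬ`.
-/

section Basic

variable {Γ : Type w} [AddGroup Γ] [DecidableEq Γ]

/-- A `Γ`-graded division ring: nonzero, and every nonzero homogeneous element is invertible. -/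
def IsGradedDivisionRing {B : Type*} [Ring B] (ℬ : Γ → AddSubgroup B) [GradedRing ℬ] : Prop :=
  Nontrivial B ∧ ∀ γ, ∀ x ∈ ℬ γ, x ≠ 0 → IsUnit x

/-- The two-sided ideal generated by the noninvertible homogeneous elements. -/
def gradedMaximalIdeal {B : Type*} [Ring B] (ℬ : Γ → AddSubgroup B) [GradedRing ℬ] : Ideal B :=
  (TwoSidedIdeal.span {x : B | (∃ γ, x ∈ ℬ γ) ∧ ¬ IsUnit x}).asIdeal

instance {B : Type*} [Ring B] (ℬ : Γ → AddSubgroup B) [GradedRing ℬ] :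
    (gradedMaximalIdeal ℬ).IsTwoSided :=
  inferInstanceAs ((TwoSidedIdeal.span _).asIdeal).IsTwoSided

/-- A `Γ`-graded local ring: the two-sided ideal generated by the noninvertible homogeneous
elements is proper. -/
def IsGradedLocal {B : Type*} [Ring B] (ℬ : Γ → AddSubgroup B) [GradedRing ℬ] : Prop :=
  gradedMaximalIdeal ℬ ≠ ⊤

/-- The ring `B ⧸ 𝔪`, where `𝔪` is generated by the noninvertible homogeneous elements. -/
abbrev GradedResidue {B : Type*} [Ring B] (ℬ : Γ → AddSubgroup B) [GradedRing ℬ] : Type _ :=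
  B ⧸ gradedMaximalIdeal ℬ

/-- The induced grading `(B ⧸ 𝔪)_γ = (B_γ + 𝔪) ⧸ 𝔪`. -/
def gradedResidueGrading {B : Type*} [Ring B] (ℬ : Γ → AddSubgroup B) [GradedRing ℬ] (γ : Γ) :
    AddSubgroup (GradedResidue ℬ) :=
  (ℬ γ).map (Ideal.Quotient.mk (gradedMaximalIdeal ℬ)).toAddMonoidHom

/-- The family `T ∩ B_γ` of additive subgroups of a subring `T` of a graded ring `B`. -/
def subringGrading {B : Type*} [Ring B] (ℬ : Γ → AddSubgroup B) (T : Subring B) (γ : Γ) :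
    AddSubgroup T :=
  (ℬ γ).comap T.subtype.toAddMonoidHom

/-- The graded division closure of a homomorphism of graded rings `f : A → B`: the least
subring of `B` that contains the image of `f` and contains the inverse of each of its homogeneous
elements that is invertible in `B`. If `B` is a graded division ring, this is the graded division
subring of `B` generated by the image of `f`. -/
def gradedDivisionClosure {A B : Type*} [Ring A] [Ring B] {𝒜 : Γ → AddSubgroup A}
    (ℬ : Γ → AddSubgroup B) (f : 𝒜 →+*ᵍ ℬ) : Subring B :=
  sInf {T : Subring B | (∀ a, f a ∈ T) ∧
    ∀ γ, ∀ x ∈ ℬ γ, x ∈ T → ∀ y, x * y = 1 → y * x = 1 → y ∈ T}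

/-- Homogeneous square matrices: those for which there are `α, β ∈ Γⁿ` such that the `(i, j)` entry
has degree `αᵢ βⱼ⁻¹`. -/
@[ext]
structure HomogeneousMatrix {R : Type u} [Ring R] (𝒜 : Γ → AddSubgroup R) : Type u where
  size : ℕ
  mat : Matrix (Fin size) (Fin size) R
  homogeneous : ∃ α β : Fin size → Γ, ∀ i j, mat i j ∈ 𝒜 (α i - β j)

/-- A criterion for gradedness through a family of projections. -/
@[reducible]
noncomputable def gradedRingOfProjections {B : Type*} [Ring B] (ℬ : Γ → AddSubgroup B)
    [SetLike.GradedMonoid ℬ] (π : Γ → B →+ B) (h₁ : ∀ γ, ∀ x ∈ ℬ γ, π γ x = x)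
    (h₂ : ∀ γ δ, γ ≠ δ → ∀ x ∈ ℬ γ, π δ x = 0) (htop : ∀ x, x ∈ (⨆ γ, ℬ γ)) :
    GradedRing ℬ :=
  have key : ∀ (y : ⨁ γ, ℬ γ) (δ : Γ), π δ (DirectSum.coeAddMonoidHom ℬ y) = (y δ : B) := by
    intro y δ
    induction y using DirectSum.induction_on with
    | zero => simp
    | of γ x =>
      rw [DirectSum.coeAddMonoidHom_of]
      by_cases h : γ = δ
      · subst h
        rw [DirectSum.of_eq_same]
        exact h₁ _ _ x.2
      · rw [DirectSum.of_eq_of_ne _ _ _ (Ne.symm h)]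
        simpa using h₂ γ δ h x x.2
    | add a b ha hb => simp [ha, hb]
  have hint : DirectSum.IsInternal ℬ := by
    refine ⟨fun y z h => ?_, fun x => ?_⟩
    · ext δ
      have h' : DirectSum.coeAddMonoidHom ℬ y = DirectSum.coeAddMonoidHom ℬ z := h
      rw [← key, ← key, h']
    · have hx := htop x
      change ∃ a, DirectSum.coeAddMonoidHom ℬ a = x
      induction hx using AddSubgroup.iSup_induction' with
      | hp γ x hx => exact ⟨DirectSum.of (fun γ => ℬ γ) γ ⟨x, hx⟩, by simp⟩
      | h1 => exact ⟨0, by simp⟩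
      | hadd a b _ _ ha hb =>
        obtain ⟨y, rfl⟩ := ha
        obtain ⟨z, rfl⟩ := hb
        exact ⟨y + z, by simp⟩
  { toDecomposition := hint.chooseDecomposition }

/-- The ring homomorphism `B → C[Γ]` that sends a homogeneous `b` of degree `γ` to `f(b)γ`. -/
noncomputable def coaction {B C : Type*} [Ring B] [Ring C] (ℬ : Γ → AddSubgroup B) [GradedRing ℬ]
    (f : B →+* C) : B →+* AddMonoidAlgebra C Γ :=
  (DirectSum.toSemiring
    (fun γ => (AddMonoidAlgebra.singleAddHom γ).comp (f.toAddMonoidHom.comp (ℬ γ).subtype))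
    (by
      change AddMonoidAlgebra.single 0 (f 1) = 1
      rw [map_one]; rfl)
    (by
      intro i j a b
      change AddMonoidAlgebra.single (i + j) (f (a * b)) =
        AddMonoidAlgebra.single i (f a) * AddMonoidAlgebra.single j (f b)
      rw [AddMonoidAlgebra.single_mul_single, map_mul])).comp
    (DirectSum.decomposeRingEquiv ℬ).toRingHom

theorem coaction_of_mem {B C : Type*} [Ring B] [Ring C] (ℬ : Γ → AddSubgroup B) [GradedRing ℬ]
    (f : B →+* C) {γ : Γ} {b : B} (hb : b ∈ ℬ γ) :
    coaction ℬ f b = AddMonoidAlgebra.single γ (f b) := by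
  have h : DirectSum.decomposeRingEquiv ℬ b = DirectSum.of (fun γ => ℬ γ) γ ⟨b, hb⟩ :=
    DirectSum.decompose_of_mem ℬ hb
  rw [coaction, RingHom.comp_apply]
  refine (congrArg _ h).trans ?_
  rw [DirectSum.toSemiring_of]
  rfl

theorem coaction_coeff {B C : Type*} [Ring B] [Ring C] (ℬ : Γ → AddSubgroup B) [GradedRing ℬ]
    (f : B →+* C) (b : B) (γ : Γ) :
    (coaction ℬ f b).coeff γ = f (DirectSum.decompose ℬ b γ) := by
  induction b using DirectSum.Decomposition.inductionOn ℬ with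
  | zero => simp
  | @homogeneous δ m =>
    rw [coaction_of_mem ℬ f m.2, DirectSum.decompose_coe, AddMonoidAlgebra.coeff_single]
    by_cases h : δ = γ
    · subst h; simp
    · rw [Finsupp.single_apply, if_neg h, DirectSum.of_eq_of_ne _ _ _ (Ne.symm h)]; simp
  | add a b ha hb => simp [ha, hb]

/-- Ring homomorphisms that agree on homogeneous elements agree. -/
theorem ringHom_ext_homogeneous {B C : Type*} [Ring B] [Ring C] (ℬ : Γ → AddSubgroup B)
    [GradedRing ℬ] {f g : B →+* C} (h : ∀ γ, ∀ b ∈ ℬ γ, f b = g b) : f = g := by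
  ext b
  induction b using DirectSum.Decomposition.inductionOn ℬ with
  | zero => simp
  | homogeneous m => exact h _ _ m.2
  | add a b ha hb => simp [ha, hb]

end Basic

section Localization

variable {Γ : Type w} [AddGroup Γ] {R : Type u} [Ring R] {𝒜 : Γ → AddSubgroup R}

/-- `f` is `Σ`-inverting: the image of each matrix of `Σ` is invertible. -/
def IsInverting {S : Type*} [Ring S] (Sig : Set (HomogeneousMatrix 𝒜)) (f : R →+* S) : Prop :=
  ∀ A ∈ Sig, IsUnit (A.mat.map f)

/-- Generators of the universal localization: a symbol for each element of `R` and symbols for the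
entries of the inverse of each matrix in `Σ`. -/
inductive UnivLoc.Gen (Sig : Set (HomogeneousMatrix 𝒜)) : Type u
  | of (r : R) : UnivLoc.Gen Sig
  | inv (A : HomogeneousMatrix 𝒜) (hA : A ∈ Sig) (i j : Fin A.size) : UnivLoc.Gen Sig

/-- Defining relations of the universal localization. -/
inductive UnivLoc.Rel (Sig : Set (HomogeneousMatrix 𝒜)) :
    FreeAlgebra ℤ (UnivLoc.Gen Sig) → FreeAlgebra ℤ (UnivLoc.Gen Sig) → Prop
  | add (r s : R) : UnivLoc.Rel Sig (FreeAlgebra.ι ℤ (.of (r + s)))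
      (FreeAlgebra.ι ℤ (.of r) + FreeAlgebra.ι ℤ (.of s))
  | mul (r s : R) : UnivLoc.Rel Sig (FreeAlgebra.ι ℤ (.of (r * s)))
      (FreeAlgebra.ι ℤ (.of r) * FreeAlgebra.ι ℤ (.of s))
  | one : UnivLoc.Rel Sig (FreeAlgebra.ι ℤ (.of 1)) 1
  | mul_inv (A : HomogeneousMatrix 𝒜) (hA : A ∈ Sig) (i j : Fin A.size) : UnivLoc.Rel Sig
      (∑ k, FreeAlgebra.ι ℤ (.of (A.mat i k)) * FreeAlgebra.ι ℤ (.inv A hA k j))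
      (if i = j then 1 else 0)
  | inv_mul (A : HomogeneousMatrix 𝒜) (hA : A ∈ Sig) (i j : Fin A.size) : UnivLoc.Rel Sig
      (∑ k, FreeAlgebra.ι ℤ (.inv A hA i k) * FreeAlgebra.ι ℤ (.of (A.mat k j)))
      (if i = j then 1 else 0)

/-- The universal localization `R_Σ` of `R` at a set `Σ` of homogeneous square matrices. -/
def UnivLoc (Sig : Set (HomogeneousMatrix 𝒜)) : Type u := RingQuot (UnivLoc.Rel Sig)

namespace UnivLoc

variable (Sig : Set (HomogeneousMatrix 𝒜))

noncomputable instance : Ring (UnivLoc Sig) := inferInstanceAs (Ring (RingQuot (UnivLoc.Rel Sig)))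

/-- The quotient map from the free ring. -/
noncomputable def mk : FreeAlgebra ℤ (Gen Sig) →+* UnivLoc Sig := RingQuot.mkRingHom (Rel Sig)

variable {Sig} in
theorem mk_rel {x y : FreeAlgebra ℤ (Gen Sig)} (h : Rel Sig x y) : mk Sig x = mk Sig y :=
  RingQuot.mkRingHom_rel h

/-- The canonical ring homomorphism `R → R_Σ`. -/
noncomputable def of : R →+* UnivLoc Sig where
  toFun r := mk Sig (FreeAlgebra.ι ℤ (.of r))
  map_one' := by rw [mk_rel Rel.one, map_one]
  map_mul' r s := by rw [mk_rel (Rel.mul r s), map_mul]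
  map_add' r s := by rw [mk_rel (Rel.add r s), map_add]
  map_zero' := by
    have h := mk_rel (Sig := Sig) (Rel.add 0 0)
    rw [add_zero, map_add] at h
    exact left_eq_add.mp h

variable {Sig} in
/-- The inverse over `R_Σ` of a matrix of `Σ`. -/
noncomputable def invMat (A : HomogeneousMatrix 𝒜) (hA : A ∈ Sig) :
    Matrix (Fin A.size) (Fin A.size) (UnivLoc Sig) :=
  Matrix.of fun i j => mk Sig (FreeAlgebra.ι ℤ (.inv A hA i j))

variable {Sig}

theorem mul_invMat (A : HomogeneousMatrix 𝒜) (hA : A ∈ Sig) :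
    A.mat.map (of Sig) * invMat A hA = 1 := by
  ext i j
  have h := mk_rel (Rel.mul_inv A hA i j)
  rw [map_sum] at h
  simp only [map_mul] at h
  rw [Matrix.mul_apply, Matrix.one_apply]
  refine Eq.trans h ?_
  split_ifs <;> simp

theorem invMat_mul (A : HomogeneousMatrix 𝒜) (hA : A ∈ Sig) :
    invMat A hA * A.mat.map (of Sig) = 1 := by
  ext i j
  have h := mk_rel (Rel.inv_mul A hA i j)
  rw [map_sum] at h
  simp only [map_mul] at h
  rw [Matrix.mul_apply, Matrix.one_apply]
  refine Eq.trans h ?_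
  split_ifs <;> simp

theorem isInverting_of : IsInverting Sig (of Sig) := fun A hA =>
  ⟨⟨_, _, mul_invMat A hA, invMat_mul A hA⟩, rfl⟩

/-- Homomorphisms from `R_Σ` are determined by their restriction to `R`. -/
theorem hom_ext {S : Type*} [Ring S] {F G : UnivLoc Sig →+* S}
    (h : ∀ r, F (of Sig r) = G (of Sig r)) : F = G := by
  have hinv : ∀ (A : HomogeneousMatrix 𝒜) (hA : A ∈ Sig),
      (invMat A hA).map F = (invMat A hA).map G := by
    intro A hA
    have h₁ : (invMat A hA).map F * (A.mat.map (of Sig)).map F = 1 := by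
      rw [← Matrix.map_mul, invMat_mul]; simp
    have h₂ : (A.mat.map (of Sig)).map F * (invMat A hA).map G = 1 := by
      have : (A.mat.map (of Sig)).map F = (A.mat.map (of Sig)).map G := by
        ext i j; exact h _
      rw [this, ← Matrix.map_mul, mul_invMat]; simp
    exact left_inv_eq_right_inv h₁ h₂
  have hcomp : F.comp (mk Sig) = G.comp (mk Sig) := by
    have : (F.comp (mk Sig)).toIntAlgHom = (G.comp (mk Sig)).toIntAlgHom := by
      apply FreeAlgebra.hom_ext
      funext g
      cases g with
      | of r => exact h r
      | inv A hA i j => exact congrFun (congrFun (hinv A hA) i) j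
    ext x
    exact DFunLike.congr_fun this x
  ext x
  obtain ⟨y, rfl⟩ := RingQuot.mkRingHom_surjective (Rel Sig) x
  exact DFunLike.congr_fun hcomp y

/-- The universal property of `R_Σ`. -/
noncomputable def lift {S : Type*} [Ring S] (f : R →+* S) (hf : IsInverting Sig f) :
    UnivLoc Sig →+* S :=
  RingQuot.lift ⟨(FreeAlgebra.lift ℤ (fun g : Gen Sig => match g with
    | .of r => f r
    | .inv A hA i j => (↑((hf A hA).unit⁻¹) : Matrix (Fin A.size) (Fin A.size) S) i j)).toRingHom, by
      intro x y hxy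
      induction hxy with
      | add r s => simp
      | mul r s => simp
      | one => simp
      | mul_inv A hA i j =>
        have h := congrFun (congrFun (hf A hA).mul_val_inv i) j
        rw [Matrix.mul_apply, Matrix.one_apply] at h
        simpa [apply_ite] using h
      | inv_mul A hA i j =>
        have h := congrFun (congrFun (hf A hA).val_inv_mul i) j
        rw [Matrix.mul_apply, Matrix.one_apply] at h
        simpa [apply_ite] using h⟩

@[simp]
theorem lift_of {S : Type*} [Ring S] (f : R →+* S) (hf : IsInverting Sig f) (r : R) :
    lift f hf (of Sig r) = f r := by
  change RingQuot.lift _ (RingQuot.mkRingHom (Rel Sig) _) = _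
  rw [RingQuot.lift_mkRingHom_apply]
  simp

theorem single_matrix_mul {C : Type*} [Ring C] {n : ℕ} {α β : Fin n → Γ}
    {M N : Matrix (Fin n) (Fin n) C} (h : M * N = 1) :
    (Matrix.of fun i j => AddMonoidAlgebra.single (α i - β j) (M i j)) *
      (Matrix.of fun i j => AddMonoidAlgebra.single (β i - α j) (N i j)) = 1 := by
  ext1 i j
  rw [Matrix.mul_apply]
  simp only [Matrix.of_apply, AddMonoidAlgebra.single_mul_single, sub_add_sub_cancel]
  have h' := congrFun (congrFun h i) j
  rw [Matrix.mul_apply] at h'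
  have : ∑ k, AddMonoidAlgebra.single (α i - α j) (M i k * N k j) =
      AddMonoidAlgebra.single (α i - α j) (∑ k, M i k * N k j) :=
    (map_sum (AddMonoidAlgebra.singleAddHom (α i - α j)) _ _).symm
  rw [this, h', Matrix.one_apply, Matrix.one_apply]
  split_ifs with hij
  · subst hij; rw [sub_self]; rfl
  · simp

section Graded

variable [DecidableEq Γ] [GradedRing 𝒜]

theorem map_coaction {C : Type*} [Ring C] (f : R →+* C) (A : HomogeneousMatrix 𝒜)
    {α β : Fin A.size → Γ} (h : ∀ i j, A.mat i j ∈ 𝒜 (α i - β j)) :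
    A.mat.map (coaction 𝒜 f) =
      Matrix.of fun i j => AddMonoidAlgebra.single (α i - β j) (f (A.mat i j)) := by
  ext1 i j
  exact coaction_of_mem 𝒜 f (h i j)

theorem isInverting_coaction {C : Type*} [Ring C] {f : R →+* C} (hf : IsInverting Sig f) :
    IsInverting Sig (coaction 𝒜 f) := by
  intro A hA
  obtain ⟨α, β, h⟩ := A.homogeneous
  rw [map_coaction f A h]
  obtain ⟨⟨M, N, hMN, hNM⟩, hM : M = A.mat.map f⟩ := hf A hA
  subst hM
  exact ⟨⟨_, _, single_matrix_mul hMN, single_matrix_mul hNM⟩, rfl⟩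

variable (Sig) in
/-- The ring homomorphism `R_Σ → R_Σ[Γ]` induced by the grading of `R`. -/
noncomputable def delta : UnivLoc Sig →+* AddMonoidAlgebra (UnivLoc Sig) Γ :=
  lift (coaction 𝒜 (of Sig)) (isInverting_coaction isInverting_of)

theorem delta_of {γ : Γ} {r : R} (hr : r ∈ 𝒜 γ) :
    delta Sig (of Sig r) = AddMonoidAlgebra.single γ (of Sig r) := by
  rw [delta, lift_of, coaction_of_mem 𝒜 _ hr]

theorem delta_invMat (A : HomogeneousMatrix 𝒜) (hA : A ∈ Sig) {α β : Fin A.size → Γ}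
    (h : ∀ i j, A.mat i j ∈ 𝒜 (α i - β j)) (i j : Fin A.size) :
    delta Sig (invMat A hA i j) = AddMonoidAlgebra.single (β i - α j) (invMat A hA i j) := by
  have h₁ : (invMat A hA).map (delta Sig) * (A.mat.map (of Sig)).map (delta Sig) = 1 := by
    rw [← Matrix.map_mul, invMat_mul]; simp
  have h₂ : (A.mat.map (of Sig)).map (delta Sig) *
      (Matrix.of fun i j => AddMonoidAlgebra.single (β i - α j) (invMat A hA i j)) = 1 := by
    have : (A.mat.map (of Sig)).map (delta Sig) =
        Matrix.of fun i j => AddMonoidAlgebra.single (α i - β j) (A.mat.map (of Sig) i j) := by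
      ext1 i j
      exact delta_of (h i j)
    rw [this]
    exact single_matrix_mul (mul_invMat A hA)
  have h₃ := left_inv_eq_right_inv h₁ h₂
  exact congrFun (congrFun h₃ i) j

variable (Sig) in
/-- The grading of `R_Σ`: the unique one for which `R → R_Σ` is a homomorphism of graded rings. An
element has degree `γ` if and only if `R_Σ → R_Σ[Γ]` sends it to its product with `γ`; the entry
`(i, j)` of the inverse of a matrix of `Σ` with degrees `αᵢ βⱼ⁻¹` has degree `βᵢ αⱼ⁻¹`. -/
def grading (γ : Γ) : AddSubgroup (UnivLoc Sig) where
  carrier := {x | delta Sig x = AddMonoidAlgebra.single γ x}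
  add_mem' {x y} hx hy := by
    change delta Sig (x + y) = _
    rw [map_add, hx, hy, AddMonoidAlgebra.single_add]
  zero_mem' := by
    change delta Sig 0 = _
    simp
  neg_mem' {x} hx := by
    change delta Sig (-x) = _
    rw [map_neg, hx]
    exact (map_neg (AddMonoidAlgebra.singleAddHom γ) x).symm

theorem of_mem_grading {γ : Γ} {r : R} (hr : r ∈ 𝒜 γ) : of Sig r ∈ grading Sig γ := delta_of hr

theorem invMat_mem_grading (A : HomogeneousMatrix 𝒜) (hA : A ∈ Sig) {α β : Fin A.size → Γ}
    (h : ∀ i j, A.mat i j ∈ 𝒜 (α i - β j)) (i j : Fin A.size) :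
    invMat A hA i j ∈ grading Sig (β i - α j) := delta_invMat A hA h i j

instance gradedMonoid : SetLike.GradedMonoid (grading Sig) where
  one_mem := by
    change delta Sig 1 = _
    rw [map_one]; rfl
  mul_mem {γ δ x y} hx hy := by
    change delta Sig (x * y) = _
    rw [map_mul, hx, hy, AddMonoidAlgebra.single_mul_single]

/-- The subring of finite sums of homogeneous elements is everything. -/
theorem mem_iSup_grading (x : UnivLoc Sig) : x ∈ ⨆ γ, grading Sig γ := by
  let T : Subring (UnivLoc Sig) := (DirectSum.coeRingHom (grading Sig)).range
  have hT : ∀ {γ x}, x ∈ grading Sig γ → x ∈ T := fun {γ x} hx =>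
    ⟨DirectSum.of (fun γ => grading Sig γ) γ ⟨x, hx⟩, DirectSum.coeRingHom_of _ _ _⟩
  have hR : ∀ r, of Sig r ∈ T := by
    intro r
    induction r using DirectSum.Decomposition.inductionOn 𝒜 with
    | zero => rw [map_zero]; exact T.zero_mem
    | homogeneous m => exact hT (of_mem_grading m.2)
    | add a b ha hb => rw [map_add]; exact T.add_mem ha hb
  let f : R →+* T := (of Sig).codRestrict T hR
  have hf : IsInverting Sig f := by
    intro A hA
    obtain ⟨α, β, h⟩ := A.homogeneous
    let N : Matrix (Fin A.size) (Fin A.size) T :=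
      Matrix.of fun i j => ⟨invMat A hA i j, hT (invMat_mem_grading A hA h i j)⟩
    have hN : N.map T.subtype = invMat A hA := rfl
    have hM : (A.mat.map f).map T.subtype = A.mat.map (of Sig) := rfl
    have hinj : Function.Injective
        (fun M : Matrix (Fin A.size) (Fin A.size) T => M.map T.subtype) :=
      Matrix.map_injective Subtype.val_injective
    refine ⟨⟨A.mat.map f, N, hinj ?_, hinj ?_⟩, rfl⟩
    · change (A.mat.map f * N).map T.subtype = (1 : Matrix _ _ T).map T.subtype
      rw [Matrix.map_mul, hN, hM, mul_invMat]; simp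
    · change (N * A.mat.map f).map T.subtype = (1 : Matrix _ _ T).map T.subtype
      rw [Matrix.map_mul, hN, hM, invMat_mul]; simp
  have hid : T.subtype.comp (lift f hf) = RingHom.id _ := by
    apply hom_ext
    intro r
    rw [RingHom.comp_apply, lift_of]
    rfl
  have hx : x ∈ T := by
    have := DFunLike.congr_fun hid x
    rw [RingHom.comp_apply, RingHom.id_apply] at this
    rw [← this]
    exact (lift f hf x).2
  obtain ⟨y, rfl⟩ := hx
  induction y using DirectSum.induction_on with
  | zero => rw [map_zero]; exact zero_mem _
  | of γ x =>
    rw [DirectSum.coeRingHom_of]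
    exact AddSubgroup.mem_iSup_of_mem γ x.2
  | add a b ha hb => rw [map_add]; exact add_mem ha hb

noncomputable instance gradedRing : GradedRing (grading Sig) :=
  gradedRingOfProjections (grading Sig)
    (fun γ => (Finsupp.applyAddHom γ).comp
      (AddMonoidAlgebra.coeffAddEquiv.toAddMonoidHom.comp (delta Sig).toAddMonoidHom))
    (fun γ x hx => by
      change (delta Sig x).coeff γ = x
      rw [show delta Sig x = _ from hx, AddMonoidAlgebra.coeff_single, Finsupp.single_eq_same])
    (fun γ δ h x hx => by
      change (delta Sig x).coeff δ = 0
      rw [show delta Sig x = _ from hx, AddMonoidAlgebra.coeff_single, Finsupp.single_apply,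
        if_neg h])
    mem_iSup_grading

variable (Sig) in
/-- The canonical homomorphism of graded rings `R → R_Σ`. -/
noncomputable def ofGr : 𝒜 →+*ᵍ grading Sig where
  toRingHom := of Sig
  map_mem := of_mem_grading

/-- The universal property of `R_Σ` for homomorphisms of graded rings. -/
noncomputable def liftGr {S : Type*} [Ring S] {𝒮 : Γ → AddSubgroup S} [GradedRing 𝒮]
    (f : 𝒜 →+*ᵍ 𝒮) (hf : IsInverting Sig f.toRingHom) : grading Sig →+*ᵍ 𝒮 where
  toRingHom := lift f.toRingHom hf
  map_mem {γ x} hx := by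
    let F := lift f.toRingHom hf
    have key : (AddMonoidAlgebra.mapRingHom Γ F).comp (delta Sig) =
        (coaction 𝒮 (RingHom.id S)).comp F := by
      apply hom_ext
      intro r
      have : ((AddMonoidAlgebra.mapRingHom Γ F).comp (delta Sig)).comp (of Sig) =
          ((coaction 𝒮 (RingHom.id S)).comp F).comp (of Sig) := by
        apply ringHom_ext_homogeneous 𝒜
        intro δ b hb
        have hFb : F (of Sig b) = f b := lift_of _ _ _
        simp only [RingHom.comp_apply]
        have hfb : f b ∈ 𝒮 δ := f.map_mem hb
        rw [delta_of hb, hFb, coaction_of_mem 𝒮 _ hfb, AddMonoidAlgebra.mapRingHom_single, hFb]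
        rfl
      exact DFunLike.congr_fun this r
    have h := congrArg (fun y => AddMonoidAlgebra.coeff y γ) (DFunLike.congr_fun key x)
    simp only [RingHom.comp_apply] at h
    rw [show delta Sig x = _ from hx, AddMonoidAlgebra.mapRingHom_single, coaction_coeff,
      AddMonoidAlgebra.coeff_single, Finsupp.single_eq_same] at h
    change F x ∈ 𝒮 γ
    rw [h]
    exact (DirectSum.decompose 𝒮 (F x) γ).2

end Graded

end UnivLoc

end Localization

section Category

variable {Γ : Type w} [AddGroup Γ] [DecidableEq Γ] {R : Type u} [Ring R]

/-- A `Γ`-graded epic `R`-division ring `(K, φ)`: a graded division ring `K` with a homomorphism of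
graded rings `φ : R → K` such that `K` is the graded division ring generated by the image of `φ`. -/
structure GrEpicDivisionRing (𝒜 : Γ → AddSubgroup R) [GradedRing 𝒜] : Type (max (u + 1) w) where
  carrier : Type u
  [ring : Ring carrier]
  grading : Γ → AddSubgroup carrier
  [gradedRing : GradedRing grading]
  hom : 𝒜 →+*ᵍ grading
  isGradedDivisionRing : IsGradedDivisionRing grading
  epic : gradedDivisionClosure grading hom = ⊤

attribute [instance] GrEpicDivisionRing.ring GrEpicDivisionRing.gradedRing

namespace GrEpicDivisionRing

variable {𝒜 : Γ → AddSubgroup R} [GradedRing 𝒜]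

/-- The set of homogeneous square matrices over `R` that become invertible over `K`. -/
def invertibleSet (K : GrEpicDivisionRing 𝒜) : Set (HomogeneousMatrix 𝒜) :=
  {A | IsUnit (A.mat.map K.hom)}

/-- The singular kernel: the set of homogeneous square matrices over `R` that do not become
invertible over `K`. -/
def singularKernel (K : GrEpicDivisionRing 𝒜) : Set (HomogeneousMatrix 𝒜) :=
  {A | ¬ IsUnit (A.mat.map K.hom)}

theorem isInverting_self (K : GrEpicDivisionRing 𝒜) :
    IsInverting K.invertibleSet K.hom.toRingHom := fun _ hA => hA

/-- The universal localization `R_Σ` at the set `Σ` of matrices that become invertible over `K`. -/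
abbrev Loc (K : GrEpicDivisionRing 𝒜) : Type u := UnivLoc K.invertibleSet

/-- The grading of `R_Σ`. -/
abbrev locGrading (K : GrEpicDivisionRing 𝒜) : Γ → AddSubgroup K.Loc :=
  UnivLoc.grading K.invertibleSet

/-- The natural homomorphism of graded `R`-rings `R_Σ → K`. -/
noncomputable def locHom (K : GrEpicDivisionRing 𝒜) : K.locGrading →+*ᵍ K.grading :=
  UnivLoc.liftGr K.hom K.isInverting_self

/-- The core of `L` in `K`: the image of the homomorphism of graded `R`-rings `Φ : R_Σ → K`, where
`Σ` is the set of matrices that become invertible over `L`. By the universal property of `R_Σ`,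
such `Φ` exists if and only if `φ : R → K` is `Σ`-inverting, and it is then unique. -/
noncomputable def core (K L : GrEpicDivisionRing 𝒜) (h : IsInverting L.invertibleSet K.hom.toRingHom) :
    Subring K.carrier :=
  (UnivLoc.liftGr K.hom h).toRingHom.range

/-- A gr-specialization from `K` to `L`: a homomorphism of graded `R`-rings from the core of
`L` in `K` (whose existence is part of the data) to `L`. -/
structure GrSpecialization (K L : GrEpicDivisionRing 𝒜) : Type u where
  inverting : IsInverting L.invertibleSet K.hom.toRingHom
  toHom : subringGrading K.grading (core K L inverting) →+*ᵍ L.grading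
  comm : ∀ (r : R) (hr : K.hom r ∈ core K L inverting), toHom ⟨K.hom r, hr⟩ = L.hom r

namespace GrSpecialization

theorem hom_mem_core {K L : GrEpicDivisionRing 𝒜}
    (h : IsInverting L.invertibleSet K.hom.toRingHom) (r : R) : K.hom r ∈ core K L h :=
  ⟨UnivLoc.of _ r, UnivLoc.lift_of _ _ _⟩

/-- The natural map `R_Σ → L` factors through the core. -/
theorem toHom_lift {K L : GrEpicDivisionRing 𝒜} (f : GrSpecialization K L) (x : L.Loc)
    (hx : UnivLoc.liftGr K.hom f.inverting x ∈ core K L f.inverting) :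
    f.toHom ⟨UnivLoc.liftGr K.hom f.inverting x, hx⟩ = L.locHom x := by
  have : (f.toHom.toRingHom.comp (UnivLoc.liftGr K.hom f.inverting).toRingHom.rangeRestrict :
      L.Loc →+* L.carrier) = L.locHom.toRingHom := by
    apply UnivLoc.hom_ext
    intro r
    have h₁ : (UnivLoc.liftGr K.hom f.inverting).toRingHom.rangeRestrict (UnivLoc.of _ r) =
        (⟨K.hom r, hom_mem_core f.inverting r⟩ : core K L f.inverting) :=
      Subtype.ext (UnivLoc.lift_of _ _ _)
    have h₂ : L.locHom.toRingHom (UnivLoc.of _ r) = L.hom r := UnivLoc.lift_of _ _ _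
    refine Eq.trans (congrArg f.toHom h₁) ?_
    exact (f.comm r _).trans h₂.symm
  exact DFunLike.congr_fun this x

/-- There is at most one gr-specialization from `K` to `L`. -/
instance (K L : GrEpicDivisionRing 𝒜) : Subsingleton (GrSpecialization K L) := by
  refine ⟨fun f g => ?_⟩
  have h : f.toHom = g.toHom := by
    apply GradedRingHom.ext
    rintro ⟨_, x, rfl⟩
    exact (f.toHom_lift x _).trans (g.toHom_lift x _).symm
  cases f
  cases g
  simp only at h
  subst h
  rfl

/-- The identity gr-specialization. -/
noncomputable def id (K : GrEpicDivisionRing 𝒜) : GrSpecialization K K where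
  inverting := K.isInverting_self
  toHom :=
    { toRingHom := (core K K K.isInverting_self).subtype
      map_mem := fun hx => hx }
  comm _ _ := rfl

theorem lift_mem_core {K L M : GrEpicDivisionRing 𝒜} (f : GrSpecialization K L)
    (g : GrSpecialization L M) :
    IsInverting M.invertibleSet K.hom.toRingHom := fun A hA => f.inverting A (g.inverting A hA)

theorem core_le {K L M : GrEpicDivisionRing 𝒜} (f : GrSpecialization K L)
    (g : GrSpecialization L M) (y : K.carrier) (hy : y ∈ core K M (lift_mem_core f g)) :
    ∃ hy' : y ∈ core K L f.inverting, f.toHom ⟨y, hy'⟩ ∈ core L M g.inverting := by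
  obtain ⟨x, rfl⟩ := hy
  let j : M.Loc →+* L.Loc := UnivLoc.lift (UnivLoc.of L.invertibleSet) (fun A hA =>
    UnivLoc.isInverting_of A (g.inverting A hA))
  have h₁ : ∀ x, UnivLoc.liftGr K.hom (lift_mem_core f g) x =
      UnivLoc.liftGr K.hom f.inverting (j x) := by
    intro x
    have : UnivLoc.lift K.hom.toRingHom (lift_mem_core f g) =
        (UnivLoc.lift K.hom.toRingHom f.inverting).comp j := by
      apply UnivLoc.hom_ext
      intro r
      refine (UnivLoc.lift_of _ _ _).trans (Eq.symm ?_)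
      exact (congrArg _ (UnivLoc.lift_of _ _ r)).trans (UnivLoc.lift_of _ _ r)
    exact DFunLike.congr_fun this x
  have h₂ : ∀ x, L.locHom (j x) = UnivLoc.liftGr L.hom g.inverting x := by
    intro x
    have : (UnivLoc.lift L.hom.toRingHom L.isInverting_self).comp j =
        UnivLoc.lift L.hom.toRingHom g.inverting := by
      apply UnivLoc.hom_ext
      intro r
      refine Eq.trans ?_ (UnivLoc.lift_of _ _ _).symm
      exact (congrArg _ (UnivLoc.lift_of _ _ r)).trans (UnivLoc.lift_of _ _ r)
    exact DFunLike.congr_fun this x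
  have h₃ : UnivLoc.liftGr K.hom f.inverting (j x) ∈ core K L f.inverting := ⟨j x, rfl⟩
  have h₄ : (UnivLoc.liftGr K.hom (lift_mem_core f g)).toRingHom x =
    UnivLoc.liftGr K.hom f.inverting (j x) := h₁ x
  refine ⟨h₄ ▸ h₃, ?_⟩
  have h₅ : f.toHom ⟨(UnivLoc.liftGr K.hom (lift_mem_core f g)).toRingHom x, h₄ ▸ h₃⟩ =
      f.toHom ⟨UnivLoc.liftGr K.hom f.inverting (j x), h₃⟩ := by
    congr 1
    exact Subtype.ext h₄
  rw [h₅, f.toHom_lift, h₂]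
  exact ⟨x, rfl⟩

/-- The composition of gr-specializations: `y ↦ g (f y)` on the core of `M` in `K`. -/
noncomputable def comp {K L M : GrEpicDivisionRing 𝒜} (f : GrSpecialization K L)
    (g : GrSpecialization L M) : GrSpecialization K M where
  inverting := lift_mem_core f g
  toHom :=
    { toFun := fun y => g.toHom ⟨f.toHom ⟨y.1, (core_le f g y.1 y.2).1⟩, (core_le f g y.1 y.2).2⟩
      map_one' := by
        refine Eq.trans (congrArg g.toHom (Subtype.ext ?_)) (map_one g.toHom)
        exact map_one f.toHom
      map_zero' := by
        refine Eq.trans (congrArg g.toHom (Subtype.ext ?_)) (map_zero g.toHom)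
        exact map_zero f.toHom
      map_mul' := fun x y => by
        refine Eq.trans (congrArg g.toHom (Subtype.ext ?_)) (map_mul g.toHom _ _)
        exact map_mul f.toHom ⟨x.1, (core_le f g x.1 x.2).1⟩ ⟨y.1, (core_le f g y.1 y.2).1⟩
      map_add' := fun x y => by
        refine Eq.trans (congrArg g.toHom (Subtype.ext ?_)) (map_add g.toHom _ _)
        exact map_add f.toHom ⟨x.1, (core_le f g x.1 x.2).1⟩ ⟨y.1, (core_le f g y.1 y.2).1⟩
      map_mem := fun {γ y} hy => by
        refine g.toHom.map_mem (i := γ) ?_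
        exact f.toHom.map_mem (i := γ)
          (x := ⟨y.1, (core_le f g y.1 y.2).1⟩) hy }
  comm r hr := by
    refine Eq.trans (congrArg g.toHom (Subtype.ext ?_)) (g.comm r (hom_mem_core g.inverting r))
    exact f.comm r _

end GrSpecialization

/-- The category of `Γ`-graded epic `R`-division rings and gr-specializations. -/
noncomputable instance : Category.{u} (GrEpicDivisionRing 𝒜) where
  Hom K L := GrSpecialization K L
  id K := GrSpecialization.id K
  comp f g := GrSpecialization.comp f g
  id_comp _ := Subsingleton.elim (α := GrSpecialization _ _) _ _
  comp_id _ := Subsingleton.elim (α := GrSpecialization _ _) _ _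
  assoc _ _ _ := Subsingleton.elim (α := GrSpecialization _ _) _ _

end GrEpicDivisionRing

end Category

section Ultraproduct

variable {Γ : Type w} {I : Type v} {B : I → Type u} [∀ i, Ring (B i)]

/-- `S_γ = ∏ᵢ (Bᵢ)_γ`, as a subgroup of `∏ᵢ Bᵢ`. -/
def homogeneousProduct (ℬ : ∀ i, Γ → AddSubgroup (B i)) (γ : Γ) : AddSubgroup (∀ i, B i) :=
  AddSubgroup.pi Set.univ fun i => ℬ i γ

theorem mem_homogeneousProduct {ℬ : ∀ i, Γ → AddSubgroup (B i)} {γ : Γ} {x : ∀ i, B i} :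
    x ∈ homogeneousProduct ℬ γ ↔ ∀ i, x i ∈ ℬ i γ := by
  simp [homogeneousProduct, AddSubgroup.mem_pi]

variable [AddGroup Γ] [DecidableEq Γ] (ℬ : ∀ i, Γ → AddSubgroup (B i)) [∀ i, GradedRing (ℬ i)]

instance : SetLike.GradedMonoid (homogeneousProduct ℬ) where
  one_mem := mem_homogeneousProduct.mpr fun i => SetLike.GradedOne.one_mem (A := ℬ i)
  mul_mem {_ _ _ _} hx hy := mem_homogeneousProduct.mpr fun i =>
    SetLike.mul_mem_graded (mem_homogeneousProduct.mp hx i) (mem_homogeneousProduct.mp hy i)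

/-- The subring `S = ⨁_γ ∏ᵢ (Bᵢ)_γ` of `∏ᵢ Bᵢ`. -/
def gradedProduct : Subring (∀ i, B i) := (DirectSum.coeRingHom (homogeneousProduct ℬ)).range

theorem mem_gradedProduct_of_mem {γ : Γ} {x : ∀ i, B i} (hx : x ∈ homogeneousProduct ℬ γ) :
    x ∈ gradedProduct ℬ :=
  ⟨DirectSum.of (fun γ => homogeneousProduct ℬ γ) γ ⟨x, hx⟩, DirectSum.coeRingHom_of _ _ _⟩

/-- The ideal `Z` of `S` of the families that vanish at `𝔘`-almost all indices. Since an element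
of `S` has only finitely many homogeneous components in `S`, this is the direct sum of the
groups `Z_γ` of the elements of `S_γ` that vanish at `𝔘`-almost all indices. -/
def gradedProductNull (𝔘 : Ultrafilter I) : Ideal (gradedProduct ℬ) where
  carrier := {x | ∀ᶠ i in (𝔘 : Filter I), x.1 i = 0}
  add_mem' {x y} hx hy := by
    filter_upwards [hx, hy] with i h₁ h₂
    change x.1 i + y.1 i = 0
    rw [h₁, h₂, add_zero]
  zero_mem' := Filter.Eventually.of_forall fun _ => rfl
  smul_mem' c x hx := by
    filter_upwards [hx] with i h
    change c.1 i * x.1 i = 0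
    rw [h, mul_zero]

instance (𝔘 : Ultrafilter I) : (gradedProductNull ℬ 𝔘).IsTwoSided where
  mul_mem_of_left {x} y hx := by
    have hx' : ∀ᶠ i in (𝔘 : Filter I), x.1 i = 0 := hx
    change ∀ᶠ i in (𝔘 : Filter I), (x * y).1 i = 0
    filter_upwards [hx'] with i h
    change x.1 i * y.1 i = 0
    rw [h, zero_mul]

/-- The graded ultraproduct `U = S ⧸ Z` of a family of graded rings. -/
def GradedUltraproduct (𝔘 : Ultrafilter I) : Type (max u v) :=
  gradedProduct ℬ ⧸ gradedProductNull ℬ 𝔘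

namespace GradedUltraproduct

variable (𝔘 : Ultrafilter I)

instance : Ring (GradedUltraproduct ℬ 𝔘) :=
  inferInstanceAs (Ring (gradedProduct ℬ ⧸ gradedProductNull ℬ 𝔘))

/-- The quotient map `S → U`. -/
def mk : gradedProduct ℬ →+* GradedUltraproduct ℬ 𝔘 := Ideal.Quotient.mk (gradedProductNull ℬ 𝔘)

theorem mk_eq_mk {x y : gradedProduct ℬ} :
    mk ℬ 𝔘 x = mk ℬ 𝔘 y ↔ ∀ᶠ i in (𝔘 : Filter I), x.1 i = y.1 i := by
  refine Ideal.Quotient.eq.trans ?_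
  change (∀ᶠ i in (𝔘 : Filter I), (x - y).1 i = 0) ↔ _
  refine Filter.eventually_congr (Filter.Eventually.of_forall fun i => ?_)
  exact sub_eq_zero

/-- The class in `U` of a family of homogeneous elements of the same degree `γ`. -/
def ofHomogeneous {γ : Γ} (x : ∀ i, ℬ i γ) : GradedUltraproduct ℬ 𝔘 :=
  mk ℬ 𝔘 ⟨fun i => (x i : B i),
    mem_gradedProduct_of_mem ℬ (mem_homogeneousProduct.mpr fun i => (x i).2)⟩

/-- The grading of the ultraproduct: `U_γ` is the image of `S_γ`. -/
def grading (γ : Γ) : AddSubgroup (GradedUltraproduct ℬ 𝔘) :=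
  (subringGrading (homogeneousProduct ℬ) (gradedProduct ℬ) γ).map (mk ℬ 𝔘).toAddMonoidHom

theorem mem_grading {γ : Γ} {y : GradedUltraproduct ℬ 𝔘} :
    y ∈ grading ℬ 𝔘 γ ↔ ∃ x : ∀ i, ℬ i γ, ofHomogeneous ℬ 𝔘 x = y := by
  constructor
  · rintro ⟨x, hx, rfl⟩
    exact ⟨fun i => ⟨x.1 i, mem_homogeneousProduct.mp hx i⟩, rfl⟩
  · rintro ⟨x, rfl⟩
    exact ⟨_, mem_homogeneousProduct.mpr fun i => (x i).2, rfl⟩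

instance : SetLike.GradedMonoid (grading ℬ 𝔘) where
  one_mem := ⟨1, SetLike.GradedOne.one_mem (A := homogeneousProduct ℬ), map_one (mk ℬ 𝔘)⟩
  mul_mem {γ δ _ _} := by
    rintro ⟨x, hx, rfl⟩ ⟨y, hy, rfl⟩
    exact ⟨x * y, SetLike.mul_mem_graded (A := homogeneousProduct ℬ) hx hy, map_mul (mk ℬ 𝔘) x y⟩

/-- The component of degree `γ` of elements of the product, with values in `U`. -/
noncomputable def projAux (γ : Γ) : gradedProduct ℬ →+ GradedUltraproduct ℬ 𝔘 where
  toFun x := ofHomogeneous ℬ 𝔘 fun i => DirectSum.decompose (ℬ i) (x.1 i) γ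
  map_zero' := by
    refine ((mk_eq_mk ℬ 𝔘).mpr (Filter.Eventually.of_forall fun i => ?_)).trans (map_zero (mk ℬ 𝔘))
    simp
  map_add' x y := by
    refine ((mk_eq_mk ℬ 𝔘).mpr (Filter.Eventually.of_forall fun i => ?_)).trans
      (map_add (mk ℬ 𝔘) _ _)
    simp

/-- The component of degree `γ` in the ultraproduct. -/
noncomputable def proj (γ : Γ) : GradedUltraproduct ℬ 𝔘 →+ GradedUltraproduct ℬ 𝔘 :=
  QuotientAddGroup.lift (Submodule.toAddSubgroup (gradedProductNull ℬ 𝔘)) (projAux ℬ 𝔘 γ) (by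
    intro x hx
    have hx' : ∀ᶠ i in (𝔘 : Filter I), x.1 i = 0 := hx
    refine ((mk_eq_mk ℬ 𝔘).mpr ?_).trans (map_zero (mk ℬ 𝔘))
    filter_upwards [hx'] with i h
    simp [h])

theorem mem_iSup_grading (y : GradedUltraproduct ℬ 𝔘) : y ∈ ⨆ γ, grading ℬ 𝔘 γ := by
  obtain ⟨⟨_, x, rfl⟩, rfl⟩ := Ideal.Quotient.mk_surjective y
  change (mk ℬ 𝔘).comp (DirectSum.coeRingHom (homogeneousProduct ℬ)).rangeRestrict x ∈ _
  induction x using DirectSum.induction_on with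
  | zero => rw [map_zero]; exact zero_mem _
  | of γ x =>
    refine AddSubgroup.mem_iSup_of_mem γ ((mem_grading ℬ 𝔘).mpr ⟨fun i =>
      ⟨x.1 i, mem_homogeneousProduct.mp x.2 i⟩, congrArg (mk ℬ 𝔘) (Subtype.ext ?_)⟩)
    exact (DirectSum.coeRingHom_of (homogeneousProduct ℬ) γ x).symm
  | add a b ha hb => rw [map_add]; exact add_mem ha hb

noncomputable instance : GradedRing (grading ℬ 𝔘) :=
  gradedRingOfProjections (grading ℬ 𝔘) (proj ℬ 𝔘)
    (by
      rintro γ _ ⟨x, hx, rfl⟩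
      refine (mk_eq_mk ℬ 𝔘).mpr (Filter.Eventually.of_forall fun i => ?_)
      exact DirectSum.decompose_of_mem_same (ℬ i) (mem_homogeneousProduct.mp hx i))
    (by
      rintro γ δ h _ ⟨x, hx, rfl⟩
      refine ((mk_eq_mk ℬ 𝔘).mpr (Filter.Eventually.of_forall fun i => ?_)).trans
        (map_zero (mk ℬ 𝔘))
      exact DirectSum.decompose_of_mem_ne (ℬ i) (mem_homogeneousProduct.mp hx i) h)
    (mem_iSup_grading ℬ 𝔘)

variable {R : Type*} [Ring R] {𝒜 : Γ → AddSubgroup R} [GradedRing 𝒜]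

theorem family_mem_gradedProduct {ℬ : ∀ i, Γ → AddSubgroup (B i)} [∀ i, GradedRing (ℬ i)]
    (φ : ∀ i, 𝒜 →+*ᵍ ℬ i) (r : R) :
    (fun i => φ i r) ∈ gradedProduct ℬ := by
  induction r using DirectSum.Decomposition.inductionOn 𝒜 with
  | zero =>
    convert (gradedProduct ℬ).zero_mem using 1
    funext i
    simp
  | @homogeneous γ m =>
    exact mem_gradedProduct_of_mem ℬ (mem_homogeneousProduct.mpr fun i => (φ i).map_mem m.2)
  | add a b ha hb =>
    convert (gradedProduct ℬ).add_mem ha hb using 1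
    funext i
    simp

variable {ℬ} in
/-- The homomorphism of graded rings `R → U`, `r ↦ [(φᵢ(r))ᵢ]`, induced by a family of
homomorphisms of graded rings `φᵢ : R → Bᵢ`. -/
def hom (φ : ∀ i, 𝒜 →+*ᵍ ℬ i) : 𝒜 →+*ᵍ grading ℬ 𝔘 where
  toRingHom := (mk ℬ 𝔘).comp
    ((RingHom.pi fun i => (φ i).toRingHom).codRestrict (gradedProduct ℬ)
      (family_mem_gradedProduct φ))
  map_mem hr := ⟨_, mem_homogeneousProduct.mpr fun i => (φ i).map_mem hr, rfl⟩

end GradedUltraproduct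

end Ultraproduct

/-! The engine is a locality statement, `isUnit_of_isUnit_lift`: if Σ consists of all the
homogeneous matrices inverted by a homomorphism f, then a homogeneous element z of R_Σ is invertible
as soon as its image is. Indeed z = d + c u, where A u = a is a homogeneous linear system over R
with A inverted by f. By Cramer's rule z is invertible exactly when the bordered matrix (A, a; -c,
d) is. The same rule over the target shows that f inverts this matrix once the image of z is a unit;
the matrix then belongs to Σ and is invertible over R_Σ.

If f goes to a graded division ring, it follows that R_Σ maps onto the graded division closure of f
(`range_liftGr`), with a kernel that contains the kernel of every graded homomorphism from R_Σ to a
nonzero graded ring (`liftGr_eq_zero_of_liftGr_eq_zero`). Hence a graded epic R-division ring is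
determined by the set of matrices that it inverts, and K specializes to L if and only if K inverts
all the matrices that L inverts. So the category is a preorder, and an inverse limit is an object
that inverts exactly the union of the Σ_i.

The ultraproduct U provides such an object: a homogeneous matrix is invertible over U if and only if
it is so over almost all K_i (`isUnit_map_hom_iff`). Since the Σ_i increase with i and the sections
lie in the ultrafilter, these matrices form the union of the Σ_i. The homomorphism V → U induced by
the Φ_i is surjective, and homogeneous elements outside its kernel are invertible, so its kernel is
the ideal 𝔪 of V. Finally, R_Σ → V is injective because its composite with V → (ultrapower of R_Σ)
is the diagonal. -/

namespace Matrix

/-! ### Schur complements and Cramer's rule over noncommutative rings. -/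

section NoncommutativeRing

variable {S : Type*} [Ring S]
variable {m n : Type*} [Fintype m] [Fintype n] [DecidableEq m] [DecidableEq n]

theorem IsUnit.submatrix {M : Matrix m m S} (h : IsUnit M) (e₁ e₂ : n ≃ m) :
    IsUnit (M.submatrix e₁ e₂) := by
  obtain ⟨⟨M, N, h₁, h₂⟩, rfl⟩ := h
  refine ⟨⟨M.submatrix e₁ e₂, N.submatrix e₂ e₁, ?_, ?_⟩, rfl⟩
  · rw [submatrix_mul_equiv, h₁, submatrix_one_equiv]
  · rw [submatrix_mul_equiv, h₂, submatrix_one_equiv]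

theorem isUnit_submatrix_iff {M : Matrix m m S} (e₁ e₂ : n ≃ m) :
    IsUnit (M.submatrix e₁ e₂) ↔ IsUnit M := by
  refine ⟨fun h => ?_, fun h => IsUnit.submatrix h e₁ e₂⟩
  have := IsUnit.submatrix h e₁.symm e₂.symm
  simpa using this

theorem isUnit_map {T : Type*} [Ring T] (f : S →+* T) {M : Matrix m m S} (h : IsUnit M) :
    IsUnit (M.map f) :=
  h.map f.mapMatrix

theorem isUnit_unit_iff {M : Matrix Unit Unit S} : IsUnit M ↔ IsUnit (M () ()) := by
  simp only [isUnit_iff_exists]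
  constructor
  · rintro ⟨N, h₁, h₂⟩
    refine ⟨N () (), ?_, ?_⟩
    · simpa [Matrix.mul_apply] using congrFun (congrFun h₁ ()) ()
    · simpa [Matrix.mul_apply] using congrFun (congrFun h₂ ()) ()
  · rintro ⟨y, h₁, h₂⟩
    refine ⟨of fun _ _ => y, ?_, ?_⟩ <;> ext <;> simpa [Matrix.mul_apply]

/-- A block matrix with invertible upper left block is invertible if and only if the Schur
complement of this block is. -/
theorem isUnit_fromBlocks_iff_isUnit_schur {A A' : Matrix m m S} (h₁ : A * A' = 1)
    (h₂ : A' * A = 1) (B : Matrix m n S) (C : Matrix n m S) (D : Matrix n n S) :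
    IsUnit (fromBlocks A B C D) ↔ IsUnit (D - C * A' * B) := by
  have hL : IsUnit (fromBlocks 1 0 (C * A') 1 : Matrix (m ⊕ n) (m ⊕ n) S) :=
    isUnit_iff_exists.mpr ⟨fromBlocks 1 0 (-(C * A')) 1, by simp [fromBlocks_multiply],
      by simp [fromBlocks_multiply]⟩
  have hR : IsUnit (fromBlocks 1 (A' * B) 0 1 : Matrix (m ⊕ n) (m ⊕ n) S) :=
    isUnit_iff_exists.mpr ⟨fromBlocks 1 (-(A' * B)) 0 1, by simp [fromBlocks_multiply],
      by simp [fromBlocks_multiply]⟩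
  -- Block LDU factorization: the two triangular factors are invertible, so only the block diagonal
  -- factor matters.
  have key : fromBlocks A B C D = fromBlocks 1 0 (C * A') 1 *
      fromBlocks A 0 0 (D - C * A' * B) * fromBlocks 1 (A' * B) 0 1 := by
    have e₁ : A * (A' * B) = B := by rw [← Matrix.mul_assoc, h₁, Matrix.one_mul]
    have e₂ : C * A' * A = C := by rw [Matrix.mul_assoc, h₂, Matrix.mul_one]
    have e₃ : C * A' * B = C * (A' * B) := Matrix.mul_assoc _ _ _
    simp [fromBlocks_multiply, e₁, e₂, e₃]
  rw [key, hR.mul_right_iff, hL.mul_left_iff]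
  constructor
  · intro h
    obtain ⟨N, hN₁, hN₂⟩ := isUnit_iff_exists.mp h
    rw [← fromBlocks_toBlocks N, fromBlocks_multiply, ← fromBlocks_one, fromBlocks_inj] at hN₁ hN₂
    refine isUnit_iff_exists.mpr ⟨N.toBlocks₂₂, ?_, ?_⟩
    · simpa using hN₁.2.2.2
    · simpa using hN₂.2.2.2
  · intro h
    obtain ⟨N, hN₁, hN₂⟩ := isUnit_iff_exists.mp h
    exact isUnit_iff_exists.mpr ⟨fromBlocks A' 0 0 N, by simp [fromBlocks_multiply, h₁, hN₁],
      by simp [fromBlocks_multiply, h₂, hN₂]⟩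

theorem isUnit_fromBlocks_of_isUnit {A : Matrix m m S} {D : Matrix n n S} (hA : IsUnit A)
    (hD : IsUnit D) (B : Matrix m n S) : IsUnit (fromBlocks A B 0 D) := by
  obtain ⟨⟨A, A', h₁, h₂⟩, rfl⟩ := hA
  simpa [isUnit_fromBlocks_iff_isUnit_schur h₁ h₂] using hD

/-- Cramer's rule: if `A u = a`, then `d + c u` is invertible if and only if the matrix
`(A, a; -c, d)` is. -/
theorem isUnit_bordered_iff {A : Matrix m m S} (hA : IsUnit A) {a u : m → S}
    (hu : A *ᵥ u = a) (c : m → S) (d : S) :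
    IsUnit (fromBlocks A (replicateCol Unit a) (-replicateRow Unit c) (of fun _ _ => d)) ↔
      IsUnit (d + c ⬝ᵥ u) := by
  obtain ⟨⟨A, A', h₁, h₂⟩, rfl⟩ := hA
  have hu' : A' *ᵥ a = u := by
    rw [← hu]
    change A' *ᵥ (A *ᵥ u) = u
    rw [mulVec_mulVec, h₂, one_mulVec]
  rw [isUnit_fromBlocks_iff_isUnit_schur h₁ h₂, isUnit_unit_iff]
  have : (-replicateRow Unit c * A' * replicateCol Unit a) () () = -(c ⬝ᵥ u) := by
    rw [Matrix.mul_assoc, ← replicateCol_mulVec, hu']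
    simp [Matrix.mul_apply, dotProduct]
  change IsUnit (d - (-replicateRow Unit c * A' * replicateCol Unit a) () ()) ↔ _
  rw [this, sub_neg_eq_add]

theorem map_bordered {T : Type*} [Ring T] (g : S →+* T) (A : Matrix m m S) (a c : m → S) (d : S) :
    (fromBlocks A (replicateCol Unit a) (-replicateRow Unit c) (of fun _ _ => d)).map g =
      fromBlocks (A.map g) (replicateCol Unit fun i => g (a i))
        (-replicateRow Unit fun i => g (c i)) (of fun _ _ => g d) := by
  rw [fromBlocks_map]
  congr 1
  ext i j
  exact map_neg g _

end NoncommutativeRing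

end Matrix

/-! ### Gaussian elimination for homogeneous matrices. -/

section GradedDivision

variable {Γ : Type w} [AddGroup Γ]

/-- A matrix with entries in `D`, homogeneous over the nonzero ring `B`, is invertible over `D` if
it is so over `B` and the elements of `D` that become homogeneous and nonzero in `B` are
invertible. -/
theorem isUnit_of_isUnit_map_of_homogeneous {D B : Type*} [Ring D] [Ring B] [Nontrivial B]
    (ℬ : Γ → AddSubgroup B) [SetLike.GradedMonoid ℬ] (f : D →+* B)
    (hf : ∀ γ d, f d ∈ ℬ γ → f d ≠ 0 → IsUnit d) (hinv : ∀ γ x y, x ∈ ℬ γ → x * y = 1 →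
      y * x = 1 → y ∈ ℬ (-γ)) (n : ℕ) (M : Matrix (Fin n) (Fin n) D) (α β : Fin n → Γ)
    (hM : ∀ i j, f (M i j) ∈ ℬ (α i - β j)) (hu : IsUnit (M.map f)) : IsUnit M := by
  induction n with
  | zero => exact ⟨⟨M, 1, Subsingleton.elim _ _, Subsingleton.elim _ _⟩, rfl⟩
  | succ n ih =>
    -- `M.map f` has a left inverse over the nonzero ring `B`, so its first column does not vanish
    -- and contains a pivot.
    obtain ⟨i₀, hi₀⟩ : ∃ i₀, f (M i₀ 0) ≠ 0 := by
      by_contra! h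
      obtain ⟨⟨M', N, h₁, h₂⟩, rfl : M' = M.map f⟩ := hu
      have := congrFun (congrFun h₂ 0) 0
      rw [Matrix.mul_apply, Matrix.one_apply_eq] at this
      simp [h] at this
    obtain ⟨⟨p, q, hpq, hqp⟩, rfl : p = M i₀ 0⟩ := hf _ _ (hM i₀ 0) hi₀
    -- A renumbering that puts `i` first; with `i₀` for rows and `0` for columns it moves the pivot
    -- to the upper left corner.
    let e (i : Fin (n + 1)) : Unit ⊕ Fin n ≃ Fin (n + 1) :=
      (Equiv.sumComm _ _).trans ((Equiv.optionEquivSumPUnit _).symm.trans (finSuccEquiv' i).symm)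
    have he : ∀ i, e i (Sum.inl ()) = i := fun i => by simp [e]
    let b : Matrix Unit (Fin n) D := Matrix.of fun _ j => M i₀ (e 0 (Sum.inr j))
    let c : Matrix (Fin n) Unit D := Matrix.of fun i _ => M (e i₀ (Sum.inr i)) 0
    let d : Matrix (Fin n) (Fin n) D :=
      Matrix.of fun i j => M (e i₀ (Sum.inr i)) (e 0 (Sum.inr j))
    let P : Matrix Unit Unit D := Matrix.of fun _ _ => M i₀ 0
    let Q : Matrix Unit Unit D := Matrix.of fun _ _ => q
    have hPQ : P * Q = 1 := by ext; simpa [P, Q, Matrix.mul_apply] using hpq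
    have hQP : Q * P = 1 := by ext; simpa [P, Q, Matrix.mul_apply] using hqp
    have hblock : M.submatrix (e i₀) (e 0) = Matrix.fromBlocks P b c d := by
      ext i j
      rcases i with i | i <;> rcases j with j | j <;> simp [P, b, c, d, he]
    rw [← Matrix.isUnit_submatrix_iff (e i₀) (e 0), hblock,
      Matrix.isUnit_fromBlocks_iff_isUnit_schur hPQ hQP]
    -- The Schur complement keeps the degrees of the remaining rows and columns: `q` has degree `β 0
    -- - α i₀`, so the inner degrees of the subtracted product telescope, even in a noncommutative
    -- group.
    refine ih _ (fun i => α (e i₀ (Sum.inr i))) (fun j => β (e 0 (Sum.inr j))) ?_ ?_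
    · intro i j
      have hentry : (d - c * Q * b) i j = M (e i₀ (Sum.inr i)) (e 0 (Sum.inr j)) -
          M (e i₀ (Sum.inr i)) 0 * q * M i₀ (e 0 (Sum.inr j)) := by
        simp [d, c, b, Q, Matrix.mul_apply]
      rw [hentry, map_sub, map_mul, map_mul]
      refine sub_mem (hM _ _) ?_
      have hq : f q ∈ ℬ (-(α i₀ - β 0)) :=
        hinv _ _ _ (hM i₀ 0) (by rw [← map_mul, hpq, map_one]) (by rw [← map_mul, hqp, map_one])
      have := SetLike.mul_mem_graded (SetLike.mul_mem_graded (hM (e i₀ (Sum.inr i)) 0) hq)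
        (hM i₀ (e 0 (Sum.inr j)))
      rwa [neg_sub, sub_add_sub_cancel, sub_add_sub_cancel] at this
    · have h₁ : P.map f * Q.map f = 1 := by rw [← Matrix.map_mul, hPQ]; simp
      have h₂ : Q.map f * P.map f = 1 := by rw [← Matrix.map_mul, hQP]; simp
      have : (d - c * Q * b).map f = d.map f - c.map f * Q.map f * b.map f := by
        rw [← Matrix.map_mul, ← Matrix.map_mul]
        ext i j
        exact map_sub f _ _
      rw [this, ← Matrix.isUnit_fromBlocks_iff_isUnit_schur h₁ h₂, ← Matrix.fromBlocks_map,
        ← hblock, ← Matrix.submatrix_map, Matrix.isUnit_submatrix_iff]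
      exact hu

end GradedDivision

/-! ### Homogeneous elements of R_Σ through linear systems over R. -/

namespace UnivLoc

open scoped Matrix

section Generation

variable {Γ : Type w} [AddGroup Γ] {R : Type u} [Ring R] {𝒜 : Γ → AddSubgroup R}
  {Sig : Set (HomogeneousMatrix 𝒜)}

/-- `R_Σ` is generated by the image of `R` and the entries of the inverses of matrices of `Σ`. -/
theorem mem_of_generators (T : Subring (UnivLoc Sig)) (hof : ∀ r, of Sig r ∈ T)
    (hinv : ∀ A hA i j, invMat (Sig := Sig) A hA i j ∈ T) (x : UnivLoc Sig) : x ∈ T := by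
  obtain ⟨y, rfl⟩ := RingQuot.mkRingHom_surjective (Rel Sig) x
  change mk Sig y ∈ T
  induction y using FreeAlgebra.induction with
  | grade0 n =>
    rw [show algebraMap ℤ (FreeAlgebra ℤ (Gen Sig)) n = (n : FreeAlgebra ℤ (Gen Sig)) from rfl,
      map_intCast]
    exact intCast_mem T n
  | grade1 g =>
    cases g with
    | of r => exact hof r
    | inv A hA i j => exact hinv A hA i j
  | mul a b ha hb => rw [map_mul]; exact mul_mem ha hb
  | add a b ha hb => rw [map_add]; exact add_mem ha hb

end Generation

section Realization

variable {Γ : Type w} [AddGroup Γ] {R : Type u} [Ring R] (𝒜 : Γ → AddSubgroup R)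
  {B : Type*} [Ring B] (f : R →+* B)

/-- The set of homogeneous square matrices that become invertible under `f`. -/
def invertedSet : Set (HomogeneousMatrix 𝒜) := {A | IsUnit (A.mat.map f)}

theorem isInverting_invertedSet : IsInverting (invertedSet 𝒜 f) f := fun _ hA => hA

variable {𝒜} in
-- Numbering the index set turns `M` into a member of `invertedSet`, which contains every
-- homogeneous matrix inverted by `f`. This admits the sum types that index block matrices.
theorem isUnit_map_of {ι : Type*} [Fintype ι] [DecidableEq ι] {M : Matrix ι ι R} {α β : ι → Γ}
    (hM : ∀ i j, M i j ∈ 𝒜 (α i - β j)) (h : IsUnit (M.map f)) :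
    IsUnit (M.map (of (invertedSet 𝒜 f))) := by
  let e := (Fintype.equivFin ι).symm
  let A : HomogeneousMatrix 𝒜 :=
    ⟨_, M.submatrix e e, α ∘ e, β ∘ e, fun i j => hM (e i) (e j)⟩
  have hA : A ∈ invertedSet 𝒜 f := by
    change IsUnit ((M.submatrix e e).map f)
    rwa [← Matrix.submatrix_map, Matrix.isUnit_submatrix_iff]
  have := isInverting_of A hA
  change IsUnit ((M.submatrix e e).map _) at this
  rwa [← Matrix.submatrix_map, Matrix.isUnit_submatrix_iff] at this

variable [DecidableEq Γ] [GradedRing 𝒜]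

/-- `z = d + c u`, where `u` is the solution of a linear system `A u = a` with `A` a matrix that
becomes invertible under `f`, and all the coefficients are homogeneous of suitable degrees. -/
def IsRealizable (γ : Γ) (z : UnivLoc (invertedSet 𝒜 f)) : Prop :=
  ∃ (ι : Type) (_ : Fintype ι) (_ : DecidableEq ι) (A : Matrix ι ι R) (a c : ι → R) (d : R)
    (u : ι → UnivLoc (invertedSet 𝒜 f)) (α β : ι → Γ),
    (∀ i j, A i j ∈ 𝒜 (α i - β j)) ∧ (∀ i, a i ∈ 𝒜 (α i)) ∧ (∀ j, c j ∈ 𝒜 (γ - β j)) ∧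
    d ∈ 𝒜 γ ∧ (∀ i, u i ∈ grading _ (β i)) ∧ IsUnit (A.map f) ∧
    A.map (of _) *ᵥ u = (fun i => of _ (a i)) ∧ z = of _ d + (fun j => of _ (c j)) ⬝ᵥ u

variable {𝒜 f} {γ γ' : Γ} {z z' : UnivLoc (invertedSet 𝒜 f)}

theorem IsRealizable.mem_grading (h : IsRealizable 𝒜 f γ z) : z ∈ grading _ γ := by
  obtain ⟨ι, _, _, A, a, c, d, u, α, β, hA, ha, hc, hd, hu, hAf, hAu, rfl⟩ := h
  refine add_mem (of_mem_grading hd) (sum_mem fun i _ => ?_)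
  have := SetLike.mul_mem_graded (of_mem_grading (Sig := invertedSet 𝒜 f) (hc i)) (hu i)
  rwa [sub_add_cancel] at this

theorem isRealizable_of {r : R} (hr : r ∈ 𝒜 γ) : IsRealizable 𝒜 f γ (of _ r) :=
  ⟨Empty, inferInstance, inferInstance, 0, 0, 0, r, 0, 0, 0, nofun, nofun, nofun, hr, nofun,
    ⟨⟨_, 1, Subsingleton.elim _ _, Subsingleton.elim _ _⟩, rfl⟩, Subsingleton.elim _ _, by simp⟩

/-- Column `j` of the inverse solves the system with right-hand side the `j`-th unit vector, and the
`i`-th unit row extracts the entry. Translating all degrees by `-α j` on the right puts the entry 1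
of both unit vectors in degree 0. -/
theorem isRealizable_invMat (A : HomogeneousMatrix 𝒜) (hA : A ∈ invertedSet 𝒜 f)
    {α β : Fin A.size → Γ} (h : ∀ i j, A.mat i j ∈ 𝒜 (α i - β j)) (i j : Fin A.size) :
    IsRealizable 𝒜 f (β i - α j) (invMat A hA i j) := by
  refine ⟨Fin A.size, inferInstance, inferInstance, A.mat, Pi.single j 1, Pi.single i 1, 0,
    fun k => invMat A hA k j, fun k => α k - α j, fun k => β k - α j, ?_, ?_, ?_,
    zero_mem _, fun k => invMat_mem_grading A hA h k j, hA, ?_, ?_⟩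
  · intro k l
    rw [sub_sub_sub_cancel_right]
    exact h k l
  · intro k
    by_cases hk : k = j
    · subst hk
      simpa using SetLike.GradedOne.one_mem (A := 𝒜)
    · rw [Pi.single_eq_of_ne hk]
      exact zero_mem _
  · intro k
    by_cases hk : k = i
    · subst hk
      simpa using SetLike.GradedOne.one_mem (A := 𝒜)
    · rw [Pi.single_eq_of_ne hk]
      exact zero_mem _
  · funext k
    have := congrFun (congrFun (mul_invMat A hA) k) j
    rw [Matrix.mul_apply] at this
    refine Eq.trans this ?_
    by_cases hk : k = j
    · subst hk; simp
    · simp [hk]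
  · have : (fun k => of (invertedSet 𝒜 f) ((Pi.single i 1 : Fin A.size → R) k)) =
        Pi.single i 1 := by
      funext k
      by_cases hk : k = i
      · subst hk; simp
      · simp [hk]
    rw [this, single_one_dotProduct, map_zero, zero_add]

theorem IsRealizable.neg (h : IsRealizable 𝒜 f γ z) : IsRealizable 𝒜 f γ (-z) := by
  obtain ⟨ι, _, _, A, a, c, d, u, α, β, hA, ha, hc, hd, hu, hAf, hAu, rfl⟩ := h
  refine ⟨ι, _, _, A, a, -c, -d, u, α, β, hA, ha, fun j => neg_mem (hc j), neg_mem hd, hu, hAf,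
    hAu, ?_⟩
  simp [dotProduct, add_comm]

theorem IsRealizable.add (h : IsRealizable 𝒜 f γ z) (h' : IsRealizable 𝒜 f γ z') :
    IsRealizable 𝒜 f γ (z + z') := by
  obtain ⟨ι, _, _, A, a, c, d, u, α, β, hA, ha, hc, hd, hu, hAf, hAu, rfl⟩ := h
  obtain ⟨ι', _, _, A', a', c', d', u', α', β', hA', ha', hc', hd', hu', hAf', hAu', rfl⟩ := h'
  refine ⟨ι ⊕ ι', inferInstance, inferInstance, Matrix.fromBlocks A 0 0 A', Sum.elim a a',
    Sum.elim c c', d + d', Sum.elim u u', Sum.elim α α', Sum.elim β β', ?_, ?_, ?_,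
    add_mem hd hd', ?_, ?_, ?_, ?_⟩
  · rintro (i | i) (j | j)
    · exact hA i j
    · exact zero_mem _
    · exact zero_mem _
    · exact hA' i j
  · rintro (i | i)
    · exact ha i
    · exact ha' i
  · rintro (i | i)
    · exact hc i
    · exact hc' i
  · rintro (i | i)
    · exact hu i
    · exact hu' i
  · rw [Matrix.fromBlocks_map, Matrix.map_zero f (map_zero f), Matrix.map_zero f (map_zero f)]
    exact Matrix.isUnit_fromBlocks_of_isUnit hAf hAf' 0
  · rw [Matrix.fromBlocks_map, Matrix.fromBlocks_mulVec]
    funext i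
    rcases i with i | i
    · simpa using congrFun hAu i
    · simpa using congrFun hAu' i
  · simp [dotProduct, add_add_add_comm]

/-- With unknowns `u z'` and `u'`, the system is A(u z') - (a c') u' = a d', A' u' = a', and z z' =
d d' + c (u z') + (d c') u'. The degrees of the first block are translated by `γ'` on the right. -/
theorem IsRealizable.mul (h : IsRealizable 𝒜 f γ z) (h' : IsRealizable 𝒜 f γ' z') :
    IsRealizable 𝒜 f (γ + γ') (z * z') := by
  have hz' := h'.mem_grading
  obtain ⟨ι, _, _, A, a, c, d, u, α, β, hA, ha, hc, hd, hu, hAf, hAu, rfl⟩ := h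
  obtain ⟨ι', _, _, A', a', c', d', u', α', β', hA', ha', hc', hd', hu', hAf', hAu', rfl⟩ := h'
  set z' := of (invertedSet 𝒜 f) d' + (fun j => of (invertedSet 𝒜 f) (c' j)) ⬝ᵥ u' with hzdef
  refine ⟨ι ⊕ ι', inferInstance, inferInstance,
    Matrix.fromBlocks A (-Matrix.of fun i j => a i * c' j) 0 A',
    Sum.elim (fun i => a i * d') a', Sum.elim c (fun j => d * c' j), d * d',
    Sum.elim (fun i => u i * z') u', Sum.elim (fun i => α i + γ') α',
    Sum.elim (fun i => β i + γ') β', ?_, ?_, ?_, SetLike.mul_mem_graded hd hd', ?_, ?_, ?_, ?_⟩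
  · rintro (i | i) (j | j)
    · change A i j ∈ 𝒜 (α i + γ' - (β j + γ'))
      rw [add_sub_add_right_eq_sub]
      exact hA i j
    · change -(a i * c' j) ∈ 𝒜 (α i + γ' - β' j)
      rw [add_sub_assoc]
      exact neg_mem (SetLike.mul_mem_graded (ha i) (hc' j))
    · exact zero_mem _
    · exact hA' i j
  · rintro (i | i)
    · exact SetLike.mul_mem_graded (ha i) hd'
    · exact ha' i
  · rintro (i | i)
    · change c i ∈ 𝒜 (γ + γ' - (β i + γ'))
      rw [add_sub_add_right_eq_sub]
      exact hc i
    · change d * c' i ∈ 𝒜 (γ + γ' - β' i)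
      rw [add_sub_assoc]
      exact SetLike.mul_mem_graded hd (hc' i)
  · rintro (i | i)
    · exact SetLike.mul_mem_graded (hu i) hz'
    · exact hu' i
  · rw [Matrix.fromBlocks_map, Matrix.map_zero f (map_zero f)]
    exact Matrix.isUnit_fromBlocks_of_isUnit hAf hAf' _
  · rw [Matrix.fromBlocks_map, Matrix.fromBlocks_mulVec]
    funext i
    rcases i with i | i
    · have h₁ : (A.map (of (invertedSet 𝒜 f)) *ᵥ fun i => u i * z') i =
          of (invertedSet 𝒜 f) (a i) * z' := by
        rw [← congrFun hAu i]
        simp only [Matrix.mulVec, dotProduct, Finset.sum_mul, mul_assoc]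
      have h₂ : ((-Matrix.of fun i j => a i * c' j).map (of (invertedSet 𝒜 f)) *ᵥ u') i =
          -(of (invertedSet 𝒜 f) (a i) * (fun j => of (invertedSet 𝒜 f) (c' j)) ⬝ᵥ u') := by
        simp [Matrix.mulVec, dotProduct, Finset.mul_sum, mul_assoc]
      change (A.map (of (invertedSet 𝒜 f)) *ᵥ fun i => u i * z') i +
        ((-Matrix.of fun i j => a i * c' j).map (of (invertedSet 𝒜 f)) *ᵥ u') i =
        of _ (a i * d')
      rw [h₁, h₂, hzdef, mul_add, add_neg_cancel_right, map_mul]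
    · simpa using congrFun hAu' i
  · have h₁ : (fun j => of (invertedSet 𝒜 f) (c j)) ⬝ᵥ (fun i => u i * z') =
        ((fun j => of (invertedSet 𝒜 f) (c j)) ⬝ᵥ u) * z' := by
      simp only [dotProduct, Finset.sum_mul, mul_assoc]
    have h₂ : (fun j => of (invertedSet 𝒜 f) (d * c' j)) ⬝ᵥ u' =
        of _ d * ((fun j => of (invertedSet 𝒜 f) (c' j)) ⬝ᵥ u') := by
      simp only [dotProduct, Finset.mul_sum, map_mul, mul_assoc]
    have h₃ : (fun j => of (invertedSet 𝒜 f) (Sum.elim c (fun j => d * c' j) j)) ⬝ᵥ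
        Sum.elim (fun i => u i * z') u' =
        (fun j => of (invertedSet 𝒜 f) (c j)) ⬝ᵥ (fun i => u i * z') +
          (fun j => of (invertedSet 𝒜 f) (d * c' j)) ⬝ᵥ u' := by
      simp [dotProduct]
    rw [h₃, h₁, h₂, add_mul, map_mul, hzdef, mul_add (of _ d), add_assoc]
    congr 1
    exact add_comm _ _

variable (𝒜 f) in
/-- The realizable elements of degree `γ`. -/
def realizable (γ : Γ) : AddSubgroup (UnivLoc (invertedSet 𝒜 f)) where
  carrier := {z | IsRealizable 𝒜 f γ z}
  add_mem' := IsRealizable.add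
  zero_mem' := by
    change IsRealizable 𝒜 f γ 0
    rw [← map_zero (of _)]
    exact isRealizable_of (zero_mem _)
  neg_mem' := IsRealizable.neg

instance : SetLike.GradedMonoid (realizable 𝒜 f) where
  one_mem := by
    change IsRealizable 𝒜 f 0 1
    rw [← map_one (of _)]
    exact isRealizable_of SetLike.GradedOne.one_mem
  mul_mem {_ _ _ _} hx hy := IsRealizable.mul hx hy

/-- The sums of realizable elements form a subring that contains the generators of R_Σ, hence
everything. Realizable elements are homogeneous, so the component of degree `γ` of such a sum is
again realizable. -/
theorem isRealizable_of_mem_grading (hz : z ∈ grading _ γ) : IsRealizable 𝒜 f γ z := by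
  have hz' : z ∈ (DirectSum.coeRingHom (realizable 𝒜 f)).range := by
    have hT : ∀ {γ x}, IsRealizable 𝒜 f γ x → x ∈ (DirectSum.coeRingHom (realizable 𝒜 f)).range :=
      fun {γ x} hx => ⟨DirectSum.of (fun γ => realizable 𝒜 f γ) γ ⟨x, hx⟩,
        DirectSum.coeRingHom_of _ _ _⟩
    refine mem_of_generators _ (fun r => ?_) (fun A hA i j => ?_) z
    · induction r using DirectSum.Decomposition.inductionOn 𝒜 with
      | zero => rw [map_zero]; exact zero_mem _
      | homogeneous m => exact hT (isRealizable_of m.2)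
      | add a b ha hb => rw [map_add]; exact add_mem ha hb
    · obtain ⟨α, β, h⟩ := A.homogeneous
      exact hT (isRealizable_invMat A hA h i j)
  obtain ⟨y, rfl⟩ := hz'
  rw [← DirectSum.decompose_of_mem_same _ hz]
  clear hz
  induction y using DirectSum.induction_on with
  | zero =>
    rw [map_zero, DirectSum.decompose_zero]
    exact (realizable 𝒜 f γ).zero_mem
  | of δ x =>
    rw [DirectSum.coeRingHom_of]
    by_cases h : δ = γ
    · subst h
      rw [DirectSum.decompose_of_mem_same _ (IsRealizable.mem_grading x.2)]
      exact x.2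
    · rw [DirectSum.decompose_of_mem_ne _ (IsRealizable.mem_grading x.2) h]
      exact (realizable 𝒜 f γ).zero_mem
  | add a b ha hb =>
    rw [map_add, DirectSum.decompose_add, DirectSum.add_apply]
    exact ha.add hb

/-- A homogeneous element of `R_Σ`, where `Σ` is the set of all the homogeneous matrices that
become invertible under `f`, is invertible as soon as its image under `f` is. -/
theorem isUnit_of_isUnit_lift (hz : z ∈ grading _ γ)
    (h : IsUnit (lift f (isInverting_invertedSet 𝒜 f) z)) : IsUnit z := by
  obtain ⟨ι, _, _, A, a, c, d, u, α, β, hA, ha, hc, hd, hu, hAf, hAu, rfl⟩ :=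
    isRealizable_of_mem_grading hz
  -- Cramer's rule over R_Σ reduces the claim to the bordered matrix over `R`, to which the
  -- maximality of Σ applies.
  rw [← Matrix.isUnit_bordered_iff (isUnit_map_of f hA hAf) hAu, ← Matrix.map_bordered]
  -- The border row gets degree `γ` and the border column degree 0, which fits the degrees of `a`,
  -- `c` and `d`.
  refine isUnit_map_of (α := Sum.elim α fun _ => γ) (β := Sum.elim β fun _ => 0) f ?_ ?_
  · rintro (i | i) (j | j)
    · exact hA i j
    · simpa using ha i
    · simpa using hc j
    · simpa using hd
  -- Cramer's rule again, now over `B`: `f` inverts the bordered matrix because the image of the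
  -- element is a unit.
  · set F := lift f (isInverting_invertedSet 𝒜 f)
    have hFr : ∀ r, F (of _ r) = f r := lift_of _ _
    have hAu' : A.map f *ᵥ (fun i => F (u i)) = fun i => f (a i) := by
      funext i
      have := congrArg F (congrFun hAu i)
      simpa [Matrix.mulVec, dotProduct, hFr] using this
    rw [Matrix.map_bordered, Matrix.isUnit_bordered_iff hAf hAu']
    simpa [dotProduct, hFr] using h

end Realization

end UnivLoc

/-! ### Homogeneous inverses and induced gradings. -/

section GradedRing

variable {Γ : Type w} [AddGroup Γ] [DecidableEq Γ] {B : Type*} [Ring B] (ℬ : Γ → AddSubgroup B)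
  [GradedRing ℬ]

/-- The inverse of an invertible homogeneous element of degree `γ` is homogeneous of
degree `γ⁻¹`. -/
theorem inverse_mem_of_mem {γ : Γ} {x y : B} (hx : x ∈ ℬ γ) (hxy : x * y = 1) (hyx : y * x = 1) :
    y ∈ ℬ (-γ) := by
  -- The component of `y` of degree `-γ` is also a right inverse of `x`, hence equals `y`.
  have h : x * (DirectSum.decompose ℬ y (-γ) : B) = 1 := by
    rw [← DirectSum.coe_decompose_mul_add_of_left_mem ℬ hx, hxy, add_neg_cancel]
    exact DirectSum.decompose_of_mem_same ℬ SetLike.GradedOne.one_mem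
  rw [left_inv_eq_right_inv hyx h]
  exact SetLike.coe_mem _

/-- A homogeneous element of the image of a homomorphism of graded rings is the image of a
homogeneous element. -/
theorem map_decompose_of_map_mem {C : Type*} [Ring C] {𝒞 : Γ → AddSubgroup C} [GradedRing 𝒞]
    (f : ℬ →+*ᵍ 𝒞) {γ : Γ} {x : B} (hx : f x ∈ 𝒞 γ) : f (DirectSum.decompose ℬ x γ) = f x := by
  rw [GradedRingHom.map_directSumDecompose]
  exact DirectSum.decompose_of_mem_same 𝒞 hx

variable {Q : Type*} [Ring Q]

/-- The grading of a ring induced by a homomorphism to a graded ring. -/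
def comapGrading (g : Q →+* B) (γ : Γ) : AddSubgroup Q := (ℬ γ).comap g.toAddMonoidHom

instance (g : Q →+* B) : SetLike.GradedMonoid (comapGrading ℬ g) where
  one_mem := by
    change g 1 ∈ ℬ 0
    rw [map_one]
    exact SetLike.GradedOne.one_mem
  mul_mem {γ δ x y} hx hy := by
    change g (x * y) ∈ ℬ (γ + δ)
    rw [map_mul]
    exact SetLike.mul_mem_graded (A := ℬ) hx hy

/-- A ring with an injective homomorphism to a graded ring is graded if the image contains the
homogeneous components of its elements. -/
@[reducible]
noncomputable def comapGradedRing (g : Q →+* B) (hg : Function.Injective g)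
    (h : ∀ q γ, ∃ q', g q' = DirectSum.decompose ℬ (g q) γ) : GradedRing (comapGrading ℬ g) :=
  gradedRingOfProjections (comapGrading ℬ g)
    (fun γ =>
      { toFun := fun q => (h q γ).choose
        map_zero' := hg (by rw [(h 0 γ).choose_spec]; simp)
        map_add' := fun x y => hg ((h (x + y) γ).choose_spec.trans (by
          rw [map_add g (h x γ).choose, (h x γ).choose_spec, (h y γ).choose_spec, map_add g]
          simp)) })
    (fun γ x hx => hg ((h x γ).choose_spec.trans (DirectSum.decompose_of_mem_same ℬ hx)))
    (fun γ δ hγδ x hx => hg (((h x δ).choose_spec.trans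
      (DirectSum.decompose_of_mem_ne ℬ hx hγδ)).trans (map_zero g).symm))
    (fun x => by
      classical
      have hx : x = ∑ γ ∈ (DirectSum.decompose ℬ (g x)).support, (h x γ).choose := by
        refine hg ?_
        rw [map_sum, Finset.sum_congr rfl fun γ _ => (h x γ).choose_spec,
          DirectSum.sum_support_decompose]
      rw [hx]
      refine sum_mem fun γ _ => AddSubgroup.mem_iSup_of_mem γ ?_
      change g _ ∈ ℬ γ
      rw [(h x γ).choose_spec]
      exact SetLike.coe_mem _)

end GradedRing

/-! ### Universal localizations and graded division closures. -/

section DivisionClosure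

variable {Γ : Type w} [AddGroup Γ] [DecidableEq Γ] {R : Type u} [Ring R] {𝒜 : Γ → AddSubgroup R}
  {B : Type*} [Ring B] {ℬ : Γ → AddSubgroup B}

theorem apply_mem_gradedDivisionClosure (f : 𝒜 →+*ᵍ ℬ) (r : R) :
    f r ∈ gradedDivisionClosure ℬ f :=
  Subring.mem_sInf.mpr fun _ hT => hT.1 r

theorem inverse_mem_gradedDivisionClosure {f : 𝒜 →+*ᵍ ℬ} {γ : Γ} {x y : B} (hx : x ∈ ℬ γ)
    (hxf : x ∈ gradedDivisionClosure ℬ f) (hxy : x * y = 1) (hyx : y * x = 1) :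
    y ∈ gradedDivisionClosure ℬ f :=
  Subring.mem_sInf.mpr fun T hT => hT.2 γ x hx (Subring.mem_sInf.mp hxf T hT) y hxy hyx

namespace UnivLoc

variable [GradedRing 𝒜] [GradedRing ℬ] {Sig : Set (HomogeneousMatrix 𝒜)} {f : 𝒜 →+*ᵍ ℬ}

theorem liftGr_of (hf : IsInverting Sig f.toRingHom) (r : R) : liftGr f hf (of Sig r) = f r :=
  lift_of _ _ _

/-- Over a graded division ring, locality only requires a nonzero image. The equation `hSig` allows
Σ to be given in another form, such as the `invertibleSet` of a different ring. -/
theorem isUnit_of_liftGr_ne_zero (hB : IsGradedDivisionRing ℬ)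
    (hSig : Sig = invertedSet 𝒜 f.toRingHom) (hf : IsInverting Sig f.toRingHom) {γ : Γ}
    {z : UnivLoc Sig} (hz : z ∈ grading Sig γ) (h : liftGr f hf z ≠ 0) : IsUnit z := by
  subst hSig
  exact isUnit_of_isUnit_lift hz (hB.2 γ _ ((liftGr f hf).map_mem hz) h)

/-- Among the homomorphisms from `R_Σ` to nonzero graded rings, those for which `Σ` is the set of
all the homogeneous matrices that become invertible over a graded division ring have the largest
kernel. -/
theorem liftGr_eq_zero_of_liftGr_eq_zero (hB : IsGradedDivisionRing ℬ)
    (hSig : Sig = invertedSet 𝒜 f.toRingHom) (hf : IsInverting Sig f.toRingHom) {C : Type*} [Ring C]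
    [Nontrivial C] {𝒞 : Γ → AddSubgroup C} [GradedRing 𝒞] (g : grading Sig →+*ᵍ 𝒞)
    {z : UnivLoc Sig} (hz : g z = 0) : liftGr f hf z = 0 := by
  classical
  rw [← DirectSum.sum_support_decompose (UnivLoc.grading Sig) z, map_sum]
  refine Finset.sum_eq_zero fun γ _ => ?_
  by_contra h
  -- A component with nonzero image would be a unit, hence nonzero under `g`; but `g` sends it to a
  -- component of 0.
  have hu := isUnit_of_liftGr_ne_zero hB hSig hf (SetLike.coe_mem _) h
  refine (hu.map g).ne_zero ?_
  rw [GradedRingHom.map_directSumDecompose, hz]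
  simp

/-- Nonzero homogeneous elements of the closure are invertible inside it, so elimination inverts the
images of the matrices of Σ there. Σ may be any set of matrices inverted by `f`. -/
theorem range_liftGr_le (hB : IsGradedDivisionRing ℬ) (hf : IsInverting Sig f.toRingHom) :
    (liftGr f hf).toRingHom.range ≤ gradedDivisionClosure ℬ f := by
  have := hB.1
  let F := (liftGr f hf).toRingHom
  let D := gradedDivisionClosure ℬ f
  have hFof : ∀ r, F (of Sig r) = f r := liftGr_of hf
  rintro _ ⟨z, rfl⟩
  refine mem_of_generators (D.comap F) (fun r => ?_) (fun A hA i j => ?_) z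
  · change F _ ∈ D
    rw [hFof]
    exact apply_mem_gradedDivisionClosure f r
  · obtain ⟨α, β, h⟩ := A.homogeneous
    let M : Matrix (Fin A.size) (Fin A.size) D :=
      Matrix.of fun i j => ⟨f (A.mat i j), apply_mem_gradedDivisionClosure f _⟩
    have hM : IsUnit M := by
      refine isUnit_of_isUnit_map_of_homogeneous ℬ D.subtype ?_
        (fun γ x y hx => inverse_mem_of_mem ℬ hx) _ M α β (fun i j => f.map_mem (h i j)) (hf A hA)
      intro γ d hd hd₀
      obtain ⟨y, h₁, h₂⟩ := isUnit_iff_exists.mp (hB.2 γ _ hd hd₀)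
      exact isUnit_iff_exists.mpr ⟨⟨y, inverse_mem_gradedDivisionClosure hd d.2 h₁ h₂⟩,
        Subtype.ext h₁, Subtype.ext h₂⟩
    obtain ⟨N, hN, -⟩ := isUnit_iff_exists.mp hM
    have hN' : A.mat.map f * N.map D.subtype = 1 := by
      have : A.mat.map f = M.map D.subtype := rfl
      rw [this, ← Matrix.map_mul, hN]
      simp
    have hinv : (invMat A hA).map F * A.mat.map f = 1 := by
      have : A.mat.map f = (A.mat.map (of Sig)).map F := by
        ext i j
        exact (hFof _).symm
      rw [this, ← Matrix.map_mul, invMat_mul]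
      simp
    have hEq := left_inv_eq_right_inv hinv hN'
    change F (invMat A hA i j) ∈ D
    rw [show F (invMat A hA i j) = _ from congrFun (congrFun hEq i) j]
    exact (N i j).2

/-- For maximal Σ the image is itself closed under homogeneous inverses: a homogeneous nonzero
element of it lifts to a homogeneous element, which is a unit of R_Σ by locality. -/
theorem range_liftGr (hB : IsGradedDivisionRing ℬ) (hSig : Sig = invertedSet 𝒜 f.toRingHom)
    (hf : IsInverting Sig f.toRingHom) :
    (liftGr f hf).toRingHom.range = gradedDivisionClosure ℬ f := by
  have := hB.1
  refine le_antisymm (range_liftGr_le hB hf) (sInf_le ⟨fun r => ⟨of Sig r, liftGr_of hf r⟩, ?_⟩)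
  rintro γ _ hx ⟨z, rfl⟩ y hxy hyx
  have hz : liftGr f hf (DirectSum.decompose (UnivLoc.grading Sig) z γ) = liftGr f hf z :=
    map_decompose_of_map_mem (UnivLoc.grading Sig) (liftGr f hf) hx
  have hz₀ : liftGr f hf z ≠ 0 := left_ne_zero_of_mul_eq_one hxy
  obtain ⟨t, ht, -⟩ := isUnit_iff_exists.mp
    (isUnit_of_liftGr_ne_zero hB hSig hf (SetLike.coe_mem (DirectSum.decompose (UnivLoc.grading Sig) z γ))
      (hz ▸ hz₀))
  refine ⟨t, (left_inv_eq_right_inv hyx ?_).symm⟩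
  have := congrArg (liftGr f hf) ht
  rwa [map_mul, hz, map_one] at this

end UnivLoc

end DivisionClosure

/-! ### Graded epic division rings and specializations in terms of inverted matrices. -/

namespace GrEpicDivisionRing

open UnivLoc

variable {Γ : Type w} [AddGroup Γ] [DecidableEq Γ] {R : Type u} [Ring R] {𝒜 : Γ → AddSubgroup R}
  [GradedRing 𝒜]

theorem locHom_surjective (K : GrEpicDivisionRing 𝒜) : Function.Surjective K.locHom := by
  have := range_liftGr K.isGradedDivisionRing (f := K.hom) rfl K.isInverting_self
  rw [K.epic] at this
  exact RingHom.range_eq_top.mp this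

theorem exists_locHom_eq (K : GrEpicDivisionRing 𝒜) {γ : Γ} {y : K.carrier}
    (hy : y ∈ K.grading γ) : ∃ z ∈ K.locGrading γ, K.locHom z = y := by
  obtain ⟨z, rfl⟩ := K.locHom_surjective y
  exact ⟨_, SetLike.coe_mem _, map_decompose_of_map_mem K.locGrading K.locHom hy⟩

theorem isUnit_of_locHom_ne_zero (K : GrEpicDivisionRing 𝒜) {γ : Γ} {z : K.Loc}
    (hz : z ∈ K.locGrading γ) (h : K.locHom z ≠ 0) : IsUnit z :=
  isUnit_of_liftGr_ne_zero K.isGradedDivisionRing rfl K.isInverting_self hz h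

theorem locHom_eq_zero (K : GrEpicDivisionRing 𝒜) {C : Type*} [Ring C]
    [Nontrivial C] {𝒞 : Γ → AddSubgroup C} [GradedRing 𝒞] (g : K.locGrading →+*ᵍ 𝒞)
    {z : K.Loc} (hz : g z = 0) : K.locHom z = 0 :=
  liftGr_eq_zero_of_liftGr_eq_zero K.isGradedDivisionRing rfl K.isInverting_self g hz

section Existence

variable {B : Type*} [Ring B] {ℬ : Γ → AddSubgroup B} [GradedRing ℬ]

/-- Every homomorphism of graded rings from `R` to a graded division ring gives rise to a graded
epic `R`-division ring over which the same matrices become invertible. -/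
theorem exists_invertibleSet_eq (hB : IsGradedDivisionRing ℬ) (f : 𝒜 →+*ᵍ ℬ) :
    ∃ K : GrEpicDivisionRing 𝒜, K.invertibleSet = invertedSet 𝒜 f.toRingHom := by
  have := hB.1
  let Sig := invertedSet 𝒜 f.toRingHom
  have hf : IsInverting Sig f.toRingHom := isInverting_invertedSet 𝒜 f.toRingHom
  let F := liftGr f hf
  -- The quotient of R_Σ stands in for the division closure in `B`: it lives in the universe of `R`,
  -- whereas `B` may not.
  let Q := UnivLoc Sig ⧸ RingHom.ker F.toRingHom
  let g : Q →+* B := RingHom.kerLift F.toRingHom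
  have hg : Function.Injective g := RingHom.kerLift_injective F.toRingHom
  let p : UnivLoc Sig →+* Q := Ideal.Quotient.mk _
  have hp : Function.Surjective p := Ideal.Quotient.mk_surjective
  have hgp : ∀ z, g (p z) = F z := fun z => rfl
  let G : Γ → AddSubgroup Q := comapGrading ℬ g
  letI : GradedRing G := comapGradedRing ℬ g hg fun q γ => by
    obtain ⟨z, rfl⟩ := hp q
    exact ⟨p (DirectSum.decompose (UnivLoc.grading Sig) z γ), (hgp _).trans (by
      rw [hgp]; exact GradedRingHom.map_directSumDecompose (UnivLoc.grading Sig) ℬ F)⟩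
  let φ : 𝒜 →+*ᵍ G :=
    { toRingHom := p.comp (of Sig)
      map_mem := fun {γ r} hr => by
        change g (p (of Sig r)) ∈ ℬ γ
        rw [hgp, liftGr_of]
        exact f.map_mem hr }
  have hdiv : IsGradedDivisionRing G := by
    refine ⟨g.domain_nontrivial, fun γ q hq hq₀ => ?_⟩
    obtain ⟨z, rfl⟩ := hp q
    have hz : F (DirectSum.decompose (UnivLoc.grading Sig) z γ) = F z :=
      map_decompose_of_map_mem (UnivLoc.grading Sig) F (x := z) (show F z ∈ ℬ γ from hq)
    have hz' : p (DirectSum.decompose (UnivLoc.grading Sig) z γ) = p z := hg hz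
    rw [← hz']
    refine (isUnit_of_liftGr_ne_zero hB rfl hf (SetLike.coe_mem _) ?_).map p
    change F _ ≠ 0
    rw [hz]
    intro h
    exact hq₀ (hg (h.trans (map_zero g).symm))
  have hφ : IsInverting Sig φ.toRingHom := fun A hA =>
    Matrix.isUnit_map p (isInverting_of A hA)
  refine ⟨⟨Q, G, φ, hdiv, ?_⟩, Set.ext fun A => ⟨fun hA => ?_, fun hA => hφ A hA⟩⟩
  -- The division closure contains the image of R_Σ, which is all of `Q`.
  · refine top_le_iff.mp fun q _ => range_liftGr_le hdiv hφ ?_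
    obtain ⟨z, rfl⟩ := hp q
    have : (liftGr φ hφ).toRingHom = p := hom_ext fun r => liftGr_of hφ r
    rw [this]
    exact ⟨z, rfl⟩
  · have h : IsUnit ((A.mat.map φ).map g) := Matrix.isUnit_map g hA
    have hmap : (A.mat.map φ).map g = A.mat.map f := by
      ext i j
      exact liftGr_of hf _
    rw [hmap] at h
    exact h

/-- A graded epic `R`-division ring is determined by the matrices that become invertible over it. -/
theorem exists_equiv_gradedDivisionClosure (K : GrEpicDivisionRing 𝒜)
    (hB : IsGradedDivisionRing ℬ) (f : 𝒜 →+*ᵍ ℬ)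
    (hK : K.invertibleSet = invertedSet 𝒜 f.toRingHom) :
    ∃ e : K.carrier ≃+* gradedDivisionClosure ℬ f, (∀ r, (e (K.hom r)).1 = f r) ∧
      ∀ γ x, e x ∈ subringGrading ℬ (gradedDivisionClosure ℬ f) γ ↔ x ∈ K.grading γ := by
  have := hB.1
  have := K.isGradedDivisionRing.1
  have hf : IsInverting K.invertibleSet f.toRingHom := by
    rw [hK]
    exact isInverting_invertedSet 𝒜 f.toRingHom
  let F := liftGr f hf
  have hrange : F.toRingHom.range = gradedDivisionClosure ℬ f := range_liftGr hB hK hf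
  let F' : K.Loc →+* gradedDivisionClosure ℬ f :=
    F.toRingHom.codRestrict _ fun z => hrange ▸ ⟨z, rfl⟩
  have hF' : Function.Surjective F' := by
    rintro ⟨y, hy⟩
    obtain ⟨z, rfl⟩ : y ∈ F.toRingHom.range := hrange ▸ hy
    exact ⟨z, rfl⟩
  -- Both homomorphisms from R_Σ have the largest possible kernel, so each kernel contains the
  -- other.
  have hker : RingHom.ker K.locHom.toRingHom = RingHom.ker F' := by
    ext z
    refine ⟨fun hz => Subtype.ext ?_, fun hz => ?_⟩
    · exact liftGr_eq_zero_of_liftGr_eq_zero hB hK hf K.locHom hz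
    · exact K.locHom_eq_zero F (congrArg Subtype.val hz)
  let e : K.carrier ≃+* gradedDivisionClosure ℬ f :=
    (RingHom.quotientKerEquivOfSurjective (f := K.locHom.toRingHom)
      K.locHom_surjective).symm.trans
      ((Ideal.quotEquivOfEq hker).trans (RingHom.quotientKerEquivOfSurjective hF'))
  have he : ∀ z, (e (K.locHom z)).1 = F z := by
    intro z
    have h : (RingHom.quotientKerEquivOfSurjective (f := K.locHom.toRingHom)
        K.locHom_surjective).symm (K.locHom z) = Ideal.Quotient.mk _ z := by
      rw [RingEquiv.symm_apply_eq]
      rfl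
    change ((Ideal.quotEquivOfEq hker).trans (RingHom.quotientKerEquivOfSurjective hF')
      ((RingHom.quotientKerEquivOfSurjective (f := K.locHom.toRingHom)
        K.locHom_surjective).symm (K.locHom z))).1 = F z
    rw [h]
    rfl
  refine ⟨e, fun r => ?_, fun γ x => ⟨fun hx => ?_, fun hx => ?_⟩⟩
  · rw [← liftGr_of hf r, ← he]
    congr 2
    exact (liftGr_of K.isInverting_self r).symm
  · obtain ⟨z, rfl⟩ := K.locHom_surjective x
    have hz : F z ∈ ℬ γ := he z ▸ hx
    have : e (K.locHom (DirectSum.decompose K.locGrading z γ)) = e (K.locHom z) :=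
      Subtype.ext (by rw [he, he]; exact map_decompose_of_map_mem K.locGrading F hz)
    rw [← e.injective this]
    exact K.locHom.map_mem (SetLike.coe_mem _)
  · obtain ⟨z, hz, rfl⟩ := K.exists_locHom_eq hx
    change (e (K.locHom z)).1 ∈ ℬ γ
    rw [he]
    exact F.map_mem hz

end Existence

section Specialization

/-- There is a gr-specialization from `K` to `L` as soon as the matrices that become invertible
over `L` do so over `K`. -/
theorem nonempty_hom_of_subset {K L : GrEpicDivisionRing 𝒜}
    (h : L.invertibleSet ⊆ K.invertibleSet) : Nonempty (K ⟶ L) := by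
  have := K.isGradedDivisionRing.1
  have hinv : IsInverting L.invertibleSet K.hom.toRingHom := fun A hA => h hA
  let Φ := liftGr K.hom hinv
  let Φ' : L.Loc →+* core K L hinv := Φ.toRingHom.rangeRestrict
  have hΦ' : Function.Surjective Φ' := Φ.toRingHom.rangeRestrict_surjective
  -- By maximality of its kernel, `L.locHom` factors through the core.
  have hker : RingHom.ker Φ' ≤ RingHom.ker L.locHom.toRingHom := fun z hz =>
    L.locHom_eq_zero Φ (congrArg Subtype.val hz)
  let s : core K L hinv →+* L.carrier := RingHom.liftOfSurjective Φ' hΦ' ⟨L.locHom.toRingHom, hker⟩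
  have hs : ∀ z, s (Φ' z) = L.locHom z := fun z =>
    RingHom.liftOfRightInverse_comp_apply Φ' _ _ ⟨L.locHom.toRingHom, hker⟩ z
  refine ⟨(⟨hinv, { toRingHom := s, map_mem := ?_ }, ?_⟩ : GrSpecialization K L)⟩
  · intro γ y hy
    obtain ⟨z, rfl⟩ := hΦ' y
    have hz : Φ' (DirectSum.decompose L.locGrading z γ) = Φ' z :=
      Subtype.ext (map_decompose_of_map_mem L.locGrading Φ hy)
    change s (Φ' z) ∈ L.grading γ
    rw [← hz, hs]
    exact L.locHom.map_mem (SetLike.coe_mem _)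
  · intro r hr
    have : (⟨K.hom r, hr⟩ : core K L hinv) = Φ' (of _ r) := Subtype.ext (liftGr_of hinv r).symm
    change s _ = _
    rw [this, hs]
    exact liftGr_of _ r

theorem invertibleSet_subset_of_hom {K L : GrEpicDivisionRing 𝒜} (f : K ⟶ L) :
    L.invertibleSet ⊆ K.invertibleSet :=
  fun A hA => GrSpecialization.inverting f A hA

instance (K L : GrEpicDivisionRing 𝒜) : Subsingleton (K ⟶ L) :=
  inferInstanceAs (Subsingleton (GrSpecialization K L))

/-- Morphisms are unique and amount to reversed inclusions of inverted sets, so a limit is a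
greatest lower bound: its inverted set is the least one containing all those of the system. -/
theorem hasLimit_of_invertibleSet_eq {J : Type*} [Category J] (F : J ⥤ GrEpicDivisionRing 𝒜)
    (K : GrEpicDivisionRing 𝒜) (hK : K.invertibleSet = ⋃ j, (F.obj j).invertibleSet) :
    HasLimit F := by
  let c : Cone F :=
    { pt := K
      π := { app := fun j => (nonempty_hom_of_subset
              (hK ▸ Set.subset_iUnion (fun j => (F.obj j).invertibleSet) j)).some
             naturality := fun _ _ _ => Subsingleton.elim _ _ } }
  refine ⟨⟨⟨c, ⟨fun s => (nonempty_hom_of_subset ?_).some, fun _ _ => Subsingleton.elim _ _,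
    fun _ _ _ => Subsingleton.elim _ _⟩⟩⟩⟩
  change K.invertibleSet ⊆ _
  rw [hK]
  exact Set.iUnion_subset fun j => invertibleSet_subset_of_hom (s.π.app j)

/-- The projections of the limit cone give one inclusion, the morphism from `K` into the limit gives
the other. -/
theorem invertibleSet_eq_of_isLimit {J : Type*} [Category J] {F : J ⥤ GrEpicDivisionRing 𝒜}
    (K : GrEpicDivisionRing 𝒜) (hK : K.invertibleSet = ⋃ j, (F.obj j).invertibleSet)
    {c : Cone F} (hc : IsLimit c) : c.pt.invertibleSet = ⋃ j, (F.obj j).invertibleSet := by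
  let c' : Cone F :=
    { pt := K
      π := { app := fun j => (nonempty_hom_of_subset
              (hK ▸ Set.subset_iUnion (fun j => (F.obj j).invertibleSet) j)).some
             naturality := fun _ _ _ => Subsingleton.elim _ _ } }
  refine subset_antisymm ?_
    (Set.iUnion_subset fun j => invertibleSet_subset_of_hom (c.π.app j))
  rw [← hK]
  exact invertibleSet_subset_of_hom (hc.lift c')

end Specialization

end GrEpicDivisionRing

/-! ### Inverses of homogeneous matrices and the ideal 𝔪. -/

section GradedMatrix

variable {Γ : Type w} [AddGroup Γ] [DecidableEq Γ] {B : Type*} [Ring B] (ℬ : Γ → AddSubgroup B)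
  [GradedRing ℬ]

/-- The inverse of a homogeneous matrix is homogeneous. -/
theorem inverse_matrix_mem {n : Type*} [Fintype n] [DecidableEq n] {M N : Matrix n n B}
    {α β : n → Γ} (hM : ∀ i j, M i j ∈ ℬ (α i - β j)) (h₁ : M * N = 1) (h₂ : N * M = 1) (i j : n) :
    N i j ∈ ℬ (β i - α j) := by
  let N' : Matrix n n B := Matrix.of fun i j => (DirectSum.decompose ℬ (N i j) (β i - α j) : B)
  -- Truncating `N` to the expected degrees replaces each entry of `M * N = 1` by its component of
  -- degree `α i - α j`, which changes nothing.
  have h : M * N' = 1 := by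
    ext i j
    have hk : ∀ k, M i k * (DirectSum.decompose ℬ (N k j) (β k - α j) : B) =
        DirectSum.decompose ℬ (M i k * N k j) (α i - α j) := by
      intro k
      rw [← DirectSum.coe_decompose_mul_add_of_left_mem ℬ (hM i k), sub_add_sub_cancel]
    have hij := congrFun (congrFun h₁ i) j
    rw [Matrix.mul_apply] at hij ⊢
    calc ∑ k, M i k * N' k j = ∑ k, (DirectSum.decompose ℬ (M i k * N k j) (α i - α j) : B) :=
          Finset.sum_congr rfl fun k _ => hk k
      _ = DirectSum.decompose ℬ (∑ k, M i k * N k j) (α i - α j) := by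
          rw [DirectSum.decompose_sum, DFinsupp.finsetSum_apply, AddSubgroup.val_finsetSum]
      _ = (1 : Matrix n n B) i j := by
          rw [hij]
          by_cases hd : i = j
          · subst hd
            rw [Matrix.one_apply_eq, sub_self]
            exact DirectSum.decompose_of_mem_same ℬ SetLike.GradedOne.one_mem
          · rw [Matrix.one_apply_ne hd]
            simp
  rw [left_inv_eq_right_inv h₂ h]
  exact SetLike.coe_mem _

variable {ℬ} in
/-- If homogeneous elements outside the kernel of a homomorphism of graded rings to a nonzero
graded ring are invertible, then the kernel is generated by the noninvertible homogeneous
elements. -/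
theorem gradedMaximalIdeal_eq_ker {C : Type*} [Ring C] [Nontrivial C] {𝒞 : Γ → AddSubgroup C}
    [GradedRing 𝒞] (f : ℬ →+*ᵍ 𝒞)
    (h : ∀ γ, ∀ x ∈ ℬ γ, f x ≠ 0 → IsUnit x) :
    gradedMaximalIdeal ℬ = RingHom.ker f.toRingHom := by
  classical
  refine le_antisymm (fun x hx => ?_) (fun x hx => ?_)
  · have hle : TwoSidedIdeal.span {x : B | (∃ γ, x ∈ ℬ γ) ∧ ¬ IsUnit x} ≤
        TwoSidedIdeal.ker f.toRingHom := by
      rw [TwoSidedIdeal.span_le]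
      rintro x ⟨⟨γ, hx⟩, hu⟩
      by_contra h₀
      exact hu (h γ x hx fun h' => h₀ ((TwoSidedIdeal.mem_ker _).mpr h'))
    exact (TwoSidedIdeal.mem_ker _).mp (hle (TwoSidedIdeal.mem_asIdeal.mp hx))
  · rw [← DirectSum.sum_support_decompose ℬ x]
    refine sum_mem fun γ _ => TwoSidedIdeal.mem_asIdeal.mpr
      (TwoSidedIdeal.subset_span ⟨⟨γ, SetLike.coe_mem _⟩, fun hu => ?_⟩)
    -- The component is sent to a component of `f x = 0`, whereas a unit has nonzero image in the
    -- nonzero ring `C`.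
    refine (hu.map f).ne_zero ?_
    rw [GradedRingHom.map_directSumDecompose, show f x = 0 from hx]
    simp

end GradedMatrix

/-! ### Units, matrices and homomorphisms in graded ultraproducts. -/

namespace GradedUltraproduct

variable {Γ : Type w} [AddGroup Γ] [DecidableEq Γ] {I : Type v} {B : I → Type u} [∀ i, Ring (B i)]
  {ℬ : ∀ i, Γ → AddSubgroup (B i)} [∀ i, GradedRing (ℬ i)] {𝔘 : Ultrafilter I}

instance [∀ i, Nontrivial (B i)] : Nontrivial (GradedUltraproduct ℬ 𝔘) := by
  refine ⟨0, 1, fun h => ?_⟩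
  rw [← map_zero (mk ℬ 𝔘), ← map_one (mk ℬ 𝔘), mk_eq_mk] at h
  obtain ⟨i, hi⟩ := h.exists
  exact zero_ne_one hi

theorem ofHomogeneous_eq_zero_iff {γ : Γ} (x : ∀ i, ℬ i γ) :
    ofHomogeneous ℬ 𝔘 x = 0 ↔ ∀ᶠ i in (𝔘 : Filter I), (x i : B i) = 0 := by
  rw [← map_zero (mk ℬ 𝔘)]
  exact mk_eq_mk ℬ 𝔘

theorem isUnit_ofHomogeneous {γ : Γ} (x : ∀ i, ℬ i γ)
    (h : ∀ᶠ i in (𝔘 : Filter I), IsUnit (x i : B i)) : IsUnit (ofHomogeneous ℬ 𝔘 x) := by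
  classical
  have hy : ∀ i, ∃ y : ℬ i (-γ), IsUnit (x i : B i) → (x i : B i) * y = 1 ∧ (y : B i) * x i = 1 := by
    intro i
    by_cases hi : IsUnit (x i : B i)
    · obtain ⟨y, h₁, h₂⟩ := isUnit_iff_exists.mp hi
      exact ⟨⟨y, inverse_mem_of_mem (ℬ i) (x i).2 h₁ h₂⟩, fun _ => ⟨h₁, h₂⟩⟩
    -- The value at these indices is irrelevant; 0 keeps the family in degree `-γ`.
    · exact ⟨0, fun h => absurd h hi⟩
  choose y hy using hy
  refine isUnit_iff_exists.mpr ⟨ofHomogeneous ℬ 𝔘 y, ?_, ?_⟩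
  · rw [← map_one (mk ℬ 𝔘), ofHomogeneous, ofHomogeneous, ← map_mul, mk_eq_mk]
    filter_upwards [h] with i hi
    exact (hy i hi).1
  · rw [← map_one (mk ℬ 𝔘), ofHomogeneous, ofHomogeneous, ← map_mul, mk_eq_mk]
    filter_upwards [h] with i hi
    exact (hy i hi).2

/-- A graded ultraproduct of graded division rings is a graded division ring. -/
theorem isGradedDivisionRing (h : ∀ i, IsGradedDivisionRing (ℬ i)) :
    IsGradedDivisionRing (grading ℬ 𝔘) := by
  have := fun i => (h i).1
  refine ⟨inferInstance, fun γ y hy hy₀ => ?_⟩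
  obtain ⟨x, rfl⟩ := (mem_grading ℬ 𝔘).mp hy
  -- Here maximality of the filter enters: not almost everywhere zero means almost everywhere
  -- nonzero.
  rw [Ne, ofHomogeneous_eq_zero_iff, ← Ultrafilter.eventually_not] at hy₀
  refine isUnit_ofHomogeneous x ?_
  filter_upwards [hy₀] with i hi
  exact (h i).2 γ _ (x i).2 hi

section Matrices

/-- The projection of the graded product to a factor. -/
def evalHom (ℬ : ∀ i, Γ → AddSubgroup (B i)) [∀ i, GradedRing (ℬ i)] (i : I) :
    gradedProduct ℬ →+* B i :=
  (Pi.evalRingHom B i).comp (gradedProduct ℬ).subtype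

theorem matrix_map_mk_eq_iff {m n : Type*} [Finite m] [Finite n]
    {X Y : Matrix m n (gradedProduct ℬ)} :
    X.map (mk ℬ 𝔘) = Y.map (mk ℬ 𝔘) ↔
      ∀ᶠ i in (𝔘 : Filter I), X.map (evalHom ℬ i) = Y.map (evalHom ℬ i) := by
  simp only [← Matrix.ext_iff, Matrix.map_apply, mk_eq_mk, Filter.eventually_all]
  rfl

variable {R : Type*} [Ring R] {𝒜 : Γ → AddSubgroup R} [GradedRing 𝒜]

/-- A homogeneous matrix becomes invertible over a graded ultraproduct if and only if it becomes
invertible over almost all the factors. -/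
theorem isUnit_map_hom_iff (φ : ∀ i, 𝒜 →+*ᵍ ℬ i) {n : Type*} [Fintype n] [DecidableEq n]
    {M : Matrix n n R} {α β : n → Γ} (hM : ∀ i j, M i j ∈ 𝒜 (α i - β j)) :
    IsUnit (M.map (hom 𝔘 φ)) ↔ ∀ᶠ i in (𝔘 : Filter I), IsUnit (M.map (φ i)) := by
  classical
  let p : R →+* gradedProduct ℬ :=
    (RingHom.pi fun i => (φ i).toRingHom).codRestrict (gradedProduct ℬ) (family_mem_gradedProduct φ)
  have hmk : M.map (hom 𝔘 φ) = (M.map p).map (mk ℬ 𝔘) := rfl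
  have hev : ∀ i, M.map (φ i) = (M.map p).map (evalHom ℬ i) := fun _ => rfl
  have hone : (1 : Matrix n n (GradedUltraproduct ℬ 𝔘)) =
      (1 : Matrix n n (gradedProduct ℬ)).map (mk ℬ 𝔘) := by simp
  have hone' : ∀ i, (1 : Matrix n n (gradedProduct ℬ)).map (evalHom ℬ i) = 1 := by simp
  constructor
  · intro h
    obtain ⟨N, h₁, h₂⟩ := isUnit_iff_exists.mp h
    obtain ⟨N, rfl⟩ : ∃ N' : Matrix n n (gradedProduct ℬ), N'.map (mk ℬ 𝔘) = N := by
      choose N' hN' using fun i j => Ideal.Quotient.mk_surjective (N i j)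
      exact ⟨Matrix.of N', Matrix.ext hN'⟩
    rw [hmk, ← Matrix.map_mul, hone, matrix_map_mk_eq_iff] at h₁ h₂
    filter_upwards [h₁, h₂] with i hi₁ hi₂
    rw [Matrix.map_mul, hone'] at hi₁ hi₂
    exact isUnit_iff_exists.mpr ⟨_, hi₁, hi₂⟩
  · intro h
    -- The entries of the inverses have degrees independent of `i`, so the family of inverses has
    -- entries in the graded product; the zero matrix fills the remaining indices.
    have hN : ∀ i, ∃ N : Matrix n n (B i), (∀ k l, N k l ∈ ℬ i (β k - α l)) ∧
        (IsUnit (M.map (φ i)) → M.map (φ i) * N = 1 ∧ N * M.map (φ i) = 1) := by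
      intro i
      by_cases hi : IsUnit (M.map (φ i))
      · obtain ⟨N, h₁, h₂⟩ := isUnit_iff_exists.mp hi
        exact ⟨N, inverse_matrix_mem (ℬ i) (fun k l => (φ i).map_mem (hM k l)) h₁ h₂,
          fun _ => ⟨h₁, h₂⟩⟩
      · exact ⟨0, fun _ _ => zero_mem _, fun h => absurd h hi⟩
    choose N hN hN' using hN
    let N' : Matrix n n (gradedProduct ℬ) := Matrix.of fun k l => ⟨fun i => N i k l,
      mem_gradedProduct_of_mem ℬ (mem_homogeneousProduct.mpr fun i => hN i k l)⟩
    have hev' : ∀ i, N'.map (evalHom ℬ i) = N i := fun _ => rfl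
    refine isUnit_iff_exists.mpr ⟨N'.map (mk ℬ 𝔘), ?_, ?_⟩ <;>
      rw [hmk, ← Matrix.map_mul, hone, matrix_map_mk_eq_iff] <;>
      filter_upwards [h] with i hi <;> rw [Matrix.map_mul, hone', ← hev, hev']
    · exact (hN' i hi).1
    · exact (hN' i hi).2

end Matrices

section Map

variable {C : I → Type*} [∀ i, Ring (C i)] {𝒞 : ∀ i, Γ → AddSubgroup (C i)} [∀ i, GradedRing (𝒞 i)]

theorem map_mem_gradedProduct (g : ∀ i, ℬ i →+*ᵍ 𝒞 i) (x : gradedProduct ℬ) :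
    (fun i => g i (x.1 i)) ∈ gradedProduct 𝒞 := by
  obtain ⟨_, y, rfl⟩ := x
  induction y using DirectSum.induction_on with
  | zero =>
    convert (gradedProduct 𝒞).zero_mem using 1
    funext i
    simp
  | of γ y =>
    refine mem_gradedProduct_of_mem 𝒞 (γ := γ) (mem_homogeneousProduct.mpr fun i => ?_)
    refine (g i).map_mem ?_
    change DirectSum.coeRingHom (homogeneousProduct ℬ)
      (DirectSum.of (fun i => homogeneousProduct ℬ i) γ y) i ∈ ℬ i γ
    rw [DirectSum.coeRingHom_of]
    exact mem_homogeneousProduct.mp y.2 i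
  | add a b ha hb =>
    convert (gradedProduct 𝒞).add_mem ha hb using 1
    funext i
    simp

variable (𝔘) in
/-- The homomorphism of graded ultraproducts induced by a family of homomorphisms of graded
rings. -/
def map (g : ∀ i, ℬ i →+*ᵍ 𝒞 i) : grading ℬ 𝔘 →+*ᵍ grading 𝒞 𝔘 where
  toRingHom := Ideal.Quotient.lift (gradedProductNull ℬ 𝔘)
    ((mk 𝒞 𝔘).comp ((RingHom.pi fun i => (g i).toRingHom.comp (evalHom ℬ i)).codRestrict
      (gradedProduct 𝒞) (map_mem_gradedProduct g)))
    (fun x hx => by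
      have hx' : ∀ᶠ i in (𝔘 : Filter I), x.1 i = 0 := hx
      refine ((mk_eq_mk 𝒞 𝔘).mpr ?_).trans (map_zero (mk 𝒞 𝔘))
      filter_upwards [hx'] with i hi
      change g i (x.1 i) = 0
      rw [hi, map_zero])
  map_mem {γ _} hy := by
    obtain ⟨x, rfl⟩ := (mem_grading ℬ 𝔘).mp hy
    exact (mem_grading 𝒞 𝔘).mpr ⟨fun i => ⟨g i (x i), (g i).map_mem (x i).2⟩, rfl⟩

theorem map_ofHomogeneous (g : ∀ i, ℬ i →+*ᵍ 𝒞 i) {γ : Γ} (x : ∀ i, ℬ i γ) :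
    map 𝔘 g (ofHomogeneous ℬ 𝔘 x) =
      ofHomogeneous 𝒞 𝔘 fun i => ⟨g i (x i), (g i).map_mem (x i).2⟩ :=
  rfl

theorem map_hom {R : Type*} [Ring R] {𝒜 : Γ → AddSubgroup R} [GradedRing 𝒜]
    (g : ∀ i, ℬ i →+*ᵍ 𝒞 i) (φ : ∀ i, 𝒜 →+*ᵍ ℬ i) (r : R) :
    map 𝔘 g (hom 𝔘 φ r) = hom 𝔘 (fun i => (g i).comp (φ i)) r :=
  rfl

/-- Lifts must be chosen in a single degree for all `i`, since an arbitrary family of lifts need not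
lie in the graded product. -/
theorem map_surjective {g : ∀ i, ℬ i →+*ᵍ 𝒞 i}
    (hg : ∀ i γ, ∀ y ∈ 𝒞 i γ, ∃ x ∈ ℬ i γ, g i x = y) : Function.Surjective (map 𝔘 g) := by
  intro y
  induction y using DirectSum.Decomposition.inductionOn (grading 𝒞 𝔘) with
  | zero => exact ⟨0, map_zero _⟩
  | @homogeneous γ m =>
    obtain ⟨x, hx⟩ := (mem_grading 𝒞 𝔘).mp m.2
    choose z hz hz' using fun i => hg i γ (x i) (x i).2
    refine ⟨ofHomogeneous ℬ 𝔘 fun i => ⟨z i, hz i⟩, ?_⟩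
    rw [map_ofHomogeneous, ← hx]
    congr 1
    funext i
    exact Subtype.ext (hz' i)
  | add a b ha hb =>
    obtain ⟨x, rfl⟩ := ha
    obtain ⟨y, rfl⟩ := hb
    exact ⟨x + y, map_add _ _ _⟩

theorem isUnit_of_map_ne_zero {g : ∀ i, ℬ i →+*ᵍ 𝒞 i}
    (hg : ∀ i γ, ∀ x ∈ ℬ i γ, g i x ≠ 0 → IsUnit x) {γ : Γ} {x : GradedUltraproduct ℬ 𝔘}
    (hx : x ∈ grading ℬ 𝔘 γ) (h : map 𝔘 g x ≠ 0) : IsUnit x := by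
  obtain ⟨x, rfl⟩ := (mem_grading ℬ 𝔘).mp hx
  rw [map_ofHomogeneous, Ne, ofHomogeneous_eq_zero_iff, ← Ultrafilter.eventually_not] at h
  refine isUnit_ofHomogeneous x ?_
  filter_upwards [h] with i hi
  exact hg i γ _ (x i).2 hi

/-- The diagonal homomorphism to a graded ultrapower is injective. -/
theorem hom_id_injective {R : Type u} [Ring R] (𝒜 : Γ → AddSubgroup R) [GradedRing 𝒜] :
    Function.Injective (hom (ℬ := fun _ : I => 𝒜) 𝔘 fun _ => GradedRingHom.id 𝒜) := by
  intro x y h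
  obtain ⟨i, hi⟩ := ((mk_eq_mk (fun _ : I => 𝒜) 𝔘).mp h).exists
  exact hi

end Map

end GradedUltraproduct

/-! ### Ultraproducts of an inverse system and the main theorem. -/

section InverseSystem

open GrEpicDivisionRing

variable {Γ : Type w} [AddGroup Γ] [DecidableEq Γ] {R : Type u} [Ring R]
  {𝒜 : Γ → AddSubgroup R} [GradedRing 𝒜] {I : Type v}

/-- Over the graded ultraproduct of an inverse system, the matrices that become invertible are
those that become invertible over some member of the system. -/
theorem invertedSet_hom_eq_iUnion [Preorder I] (F : Iᵒᵖ ⥤ GrEpicDivisionRing 𝒜)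
    {𝔘 : Ultrafilter I} (h𝔘 : ∀ i : I, {j : I | i ≤ j} ∈ 𝔘) :
    UnivLoc.invertedSet 𝒜
        (GradedUltraproduct.hom 𝔘 fun i => (F.obj (op i)).hom : 𝒜 →+*ᵍ _).toRingHom =
      ⋃ i, (F.obj (op i)).invertibleSet := by
  ext A
  obtain ⟨α, β, hA⟩ := A.homogeneous
  refine (GradedUltraproduct.isUnit_map_hom_iff (𝔘 := 𝔘) (fun i => (F.obj (op i)).hom) hA).trans ?_
  rw [Set.mem_iUnion]
  -- A set in the ultrafilter is nonempty. Conversely, a matrix inverted over `K_i` is inverted over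
  -- `K_j` for all `j ≥ i`, through the specialization from `K_j` to `K_i`.
  refine ⟨fun h => h.exists, fun ⟨i, hi⟩ => ?_⟩
  filter_upwards [h𝔘 i] with j hj
  exact invertibleSet_subset_of_hom (F.map (homOfLE hj).op) hi

/-- The universal localization at the union of the sets of matrices that become invertible over
the members of an inverse system embeds into the graded ultraproduct of the localizations at these
sets. -/
theorem exists_injective_hom_ultraproduct_loc [Preorder I] (F : Iᵒᵖ ⥤ GrEpicDivisionRing 𝒜)
    {𝔘 : Ultrafilter I} (h𝔘 : ∀ i : I, {j : I | i ≤ j} ∈ 𝔘) {Sig : Set (HomogeneousMatrix 𝒜)}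
    (hSig : Sig = ⋃ i, (F.obj (op i)).invertibleSet) :
    ∃ ρ : UnivLoc.grading Sig →+*ᵍ
        GradedUltraproduct.grading (fun i => (F.obj (op i)).locGrading) 𝔘,
      Function.Injective ρ ∧ ∀ r, ρ (UnivLoc.ofGr Sig r) =
        GradedUltraproduct.hom 𝔘 (fun i => UnivLoc.ofGr (F.obj (op i)).invertibleSet) r := by
  let toV := GradedUltraproduct.hom 𝔘 fun i => UnivLoc.ofGr (F.obj (op i)).invertibleSet
  have hinv : IsInverting Sig toV.toRingHom := by
    intro A hA
    rw [hSig, Set.mem_iUnion] at hA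
    obtain ⟨i, hi⟩ := hA
    obtain ⟨α, β, hA⟩ := A.homogeneous
    refine (GradedUltraproduct.isUnit_map_hom_iff (𝔘 := 𝔘)
      (fun i => UnivLoc.ofGr (F.obj (op i)).invertibleSet) hA).mpr ?_
    filter_upwards [h𝔘 i] with j hj
    exact UnivLoc.isInverting_of A (invertibleSet_subset_of_hom (F.map (homOfLE hj).op) hi)
  let g (i : I) : (F.obj (op i)).locGrading →+*ᵍ UnivLoc.grading Sig :=
    UnivLoc.liftGr (UnivLoc.ofGr Sig) fun A hA =>
      UnivLoc.isInverting_of A (hSig ▸ Set.mem_iUnion.mpr ⟨i, hA⟩)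
  have hg : ∀ i, (g i).comp (UnivLoc.ofGr (F.obj (op i)).invertibleSet) =
      (GradedRingHom.id _).comp (UnivLoc.ofGr Sig) := fun i =>
    GradedRingHom.ext fun r => UnivLoc.liftGr_of _ r
  let ρ := UnivLoc.liftGr toV hinv
  let G := GradedUltraproduct.map 𝔘 g
  let Δ := GradedUltraproduct.hom (ℬ := fun _ : I => UnivLoc.grading Sig) 𝔘
    fun _ => GradedRingHom.id (UnivLoc.grading Sig)
  -- Both sides are the diagonal on `R`, hence agree on R_Σ; injectivity of the diagonal passes to
  -- `ρ`.
  have hcomp : G.toRingHom.comp ρ.toRingHom = Δ.toRingHom := by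
    refine UnivLoc.hom_ext fun r => ?_
    change G (ρ (UnivLoc.of Sig r)) = Δ (UnivLoc.of Sig r)
    rw [UnivLoc.liftGr_of]
    refine (GradedUltraproduct.map_hom g _ r).trans ?_
    simp only [hg]
    rfl
  refine ⟨ρ, fun x y hxy => ?_, UnivLoc.liftGr_of hinv⟩
  refine GradedUltraproduct.hom_id_injective (𝔘 := 𝔘) (UnivLoc.grading Sig) ?_
  have hx : G (ρ x) = Δ x := DFunLike.congr_fun hcomp x
  have hy : G (ρ y) = Δ y := DFunLike.congr_fun hcomp y
  exact hx.symm.trans ((congrArg G hxy).trans hy)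

/-- The graded ultraproduct `V` of the localizations `R_{Σᵢ}` is graded local, with residue ring
the graded ultraproduct of the graded division rings. -/
theorem exists_residue_equiv_ultraproduct (K : I → GrEpicDivisionRing 𝒜) (𝔘 : Ultrafilter I) :
    IsGradedLocal (GradedUltraproduct.grading (fun i => (K i).locGrading) 𝔘) ∧
    ∃ e : GradedResidue (GradedUltraproduct.grading (fun i => (K i).locGrading) 𝔘) ≃+*
        GradedUltraproduct (fun i => (K i).grading) 𝔘,
      (∀ x, e (Ideal.Quotient.mk _ x) = GradedUltraproduct.map 𝔘 (fun i => (K i).locHom) x) ∧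
      ∀ γ x, e x ∈ GradedUltraproduct.grading (fun i => (K i).grading) 𝔘 γ ↔
        x ∈ gradedResidueGrading (GradedUltraproduct.grading (fun i => (K i).locGrading) 𝔘) γ := by
  have := fun i => (K i).isGradedDivisionRing.1
  let Θ := GradedUltraproduct.map 𝔘 fun i => (K i).locHom
  have hΘ : Function.Surjective Θ.toRingHom :=
    GradedUltraproduct.map_surjective fun i _ _ hy => (K i).exists_locHom_eq hy
  have hker := gradedMaximalIdeal_eq_ker Θ fun γ x hx =>
    GradedUltraproduct.isUnit_of_map_ne_zero
      (fun i _ _ hx => (K i).isUnit_of_locHom_ne_zero hx) hx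
  refine ⟨fun h => RingHom.ker_ne_top Θ.toRingHom (hker.symm.trans h),
    (Ideal.quotEquivOfEq hker).trans (RingHom.quotientKerEquivOfSurjective hΘ),
    fun _ => rfl, fun γ x => ⟨fun hx => ?_, ?_⟩⟩
  · obtain ⟨x, rfl⟩ := Ideal.Quotient.mk_surjective x
    -- If `Θ x` is homogeneous of degree `γ`, then `x` differs from its component of degree `γ` by
    -- an element of the kernel.
    refine ⟨_, SetLike.coe_mem (DirectSum.decompose _ x γ), Ideal.Quotient.eq.mpr ?_⟩
    rw [hker, RingHom.mem_ker, map_sub, sub_eq_zero]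
    exact map_decompose_of_map_mem _ Θ hx
  · rintro ⟨x, hx, rfl⟩
    exact Θ.map_mem hx

end InverseSystem

theorem mainTheorem12 {Γ : Type w} [AddGroup Γ] [DecidableEq Γ] {R : Type u} [Ring R]
    (𝒜 : Γ → AddSubgroup R) [GradedRing 𝒜]
    {I : Type v} [Preorder I] [IsDirectedOrder I] [Nonempty I]
    (F : Iᵒᵖ ⥤ GrEpicDivisionRing 𝒜) :
    let K : I → GrEpicDivisionRing 𝒜 := fun i => F.obj (op i)
    HasLimit F ∧
    (∀ (c : Cone F) (_ : IsLimit c),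
      c.pt.singularKernel = ⋂ i, (K i).singularKernel ∧
      c.pt.invertibleSet = ⋃ i, (K i).invertibleSet) ∧
    ∀ 𝔘 : Ultrafilter I, (∀ i : I, {j : I | i ≤ j} ∈ 𝔘) →
      let 𝒰 := GradedUltraproduct.grading (fun i => (K i).grading) 𝔘
      let toU : 𝒜 →+*ᵍ 𝒰 := GradedUltraproduct.hom 𝔘 fun i => (K i).hom
      let 𝒱 := GradedUltraproduct.grading (fun i => (K i).locGrading) 𝔘
      let toV : 𝒜 →+*ᵍ 𝒱 := GradedUltraproduct.hom 𝔘 fun i => UnivLoc.ofGr (K i).invertibleSet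
      IsGradedDivisionRing 𝒰 ∧
      (∀ (c : Cone F) (_ : IsLimit c),
        ∃ e : c.pt.carrier ≃+* gradedDivisionClosure 𝒰 toU,
          (∀ r, (e (c.pt.hom r)).1 = toU r) ∧
          ∀ γ x, e x ∈ subringGrading 𝒰 (gradedDivisionClosure 𝒰 toU) γ ↔ x ∈ c.pt.grading γ) ∧
      IsGradedLocal 𝒱 ∧
      (∃ e : GradedResidue 𝒱 ≃+* GradedUltraproduct (fun i => (K i).grading) 𝔘,
        (∀ r, e (Ideal.Quotient.mk _ (toV r)) = toU r) ∧
        (∀ γ x, e x ∈ 𝒰 γ ↔ x ∈ gradedResidueGrading 𝒱 γ) ∧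
        ∀ γ (x : ∀ i, (K i).locGrading γ),
          e (Ideal.Quotient.mk _ (GradedUltraproduct.ofHomogeneous _ 𝔘 x)) =
            GradedUltraproduct.ofHomogeneous (fun i => (K i).grading) 𝔘
              fun i => ⟨(K i).locHom (x i), (K i).locHom.map_mem (x i).2⟩) ∧
      (∀ (c : Cone F) (_ : IsLimit c),
        ∃ ρ : c.pt.locGrading →+*ᵍ 𝒱, Function.Injective ρ ∧
          ∀ r, ρ (UnivLoc.ofGr c.pt.invertibleSet r) = toV r) := by
  intro K
  -- Existence of the limit needs only one ultrafilter containing the sections; one finer than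
  -- `Filter.atTop` exists because `I` is directed and nonempty.
  have hexists : ∃ L : GrEpicDivisionRing 𝒜,
      L.invertibleSet = ⋃ j, (F.obj j).invertibleSet := by
    obtain ⟨L, hL⟩ := GrEpicDivisionRing.exists_invertibleSet_eq
      (GradedUltraproduct.isGradedDivisionRing (𝔘 := Ultrafilter.of Filter.atTop)
        fun i => (K i).isGradedDivisionRing)
      (GradedUltraproduct.hom _ fun i => (K i).hom)
    refine ⟨L, hL.trans ((invertedSet_hom_eq_iUnion F fun i =>
      Ultrafilter.of_le _ (Filter.Ici_mem_atTop i)).trans ?_)⟩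
    exact (equivToOpposite.surjective.iUnion_comp fun j => (F.obj j).invertibleSet)
  obtain ⟨L, hL⟩ := hexists
  have hlim : ∀ (c : Cone F) (_ : IsLimit c),
      c.pt.invertibleSet = ⋃ i, (K i).invertibleSet := fun c hc =>
    (GrEpicDivisionRing.invertibleSet_eq_of_isLimit L hL hc).trans
      (equivToOpposite.surjective.iUnion_comp fun j => (F.obj j).invertibleSet).symm
  refine ⟨GrEpicDivisionRing.hasLimit_of_invertibleSet_eq F L hL, fun c hc => ⟨?_, hlim c hc⟩, ?_⟩
  · have hcompl : ∀ M : GrEpicDivisionRing 𝒜, M.singularKernel = M.invertibleSetᶜ := fun _ => rfl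
    simp only [hcompl, hlim c hc, Set.compl_iUnion]
  intro 𝔘 h𝔘 𝒰 toU 𝒱 toV
  have hU : IsGradedDivisionRing 𝒰 :=
    GradedUltraproduct.isGradedDivisionRing fun i => (K i).isGradedDivisionRing
  obtain ⟨hlocal, e, he, hgr⟩ := exists_residue_equiv_ultraproduct K 𝔘
  refine ⟨hU, fun c hc => ?_, hlocal, ⟨e, fun r => ?_, hgr, fun γ x => he _⟩, fun c hc =>
    exists_injective_hom_ultraproduct_loc F h𝔘 (hlim c hc)⟩
  · exact c.pt.exists_equiv_gradedDivisionClosure hU toU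
      ((hlim c hc).trans (invertedSet_hom_eq_iUnion F h𝔘).symm)
  · have hcomp : ∀ i, (K i).locHom.comp (UnivLoc.ofGr (K i).invertibleSet) = (K i).hom := fun i =>
      GradedRingHom.ext fun s => UnivLoc.liftGr_of _ s
    rw [he]
    refine (GradedUltraproduct.map_hom _ _ r).trans ?_
    simp only [hcomp]
    rfl
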